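/- Let $k>1$ be a square-free integer, put $k_0=2$ if $k\equiv 1 \bmod 4$ and $k_0=1$ otherwise, and let $\omega=\frac{1+\sqrt{k}}{k_0}$, $\omega'=\frac{1-\sqrt{k}}{k_0}$ and $R=\mathbb{Z}[\omega]$, the ring of integers of $\mathbb{Q}(\sqrt{k})$. For $\alpha=\alpha_0+\alpha_1\omega\in R$ with $\alpha_0,\alpha_1\in\mathbb{Z}$ write $\alpha'=\alpha_0+\alpha_1\omega'$, and let $\epsilon_0$ be the smallest unit of $R$ that is greater than $1$. Let $\mathbb{H}^2$ be the upper half plane. The group $\Gamma=\mathrm{PSL}_2(R)$ acts on $\mathbb{H}^2\times\mathbb{H}^2$ by letting the class of a matrix $A\in \mathrm{SL}_2(R)$ act as the pair $(A,A')$ of Möbius transformations, where $A'$ is obtained by applying $'$ to the entries of $A$. For $Z=(x_1+y_1i,\,x_2+y_2i)\in\mathbb{H}^2\times\mathbb{H}^2$ define $s_1,s_2\in\mathbb{R}$ by $x_1=s_1+s_2\omega$, $x_2=s_1+s_2\omega'$, put $r=y_1/y_2$, and for $c,d\in R$ put $$\Vert cZ+d\Vert=\big((cx_1+d)^2+c^2y_1^2\big)\big((c'x_2+d')^2+c'^2y_2^2\big).$$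 Let $\mathcal{F}$ be the set of all $Z\in\mathbb{H}^2\times\mathbb{H}^2$ such that $|s_1|\le\frac12$, $|s_2|\le\frac12$, $\epsilon_0^{-2}\le r\le\epsilon_0^{2}$, and $\Vert cZ+d\Vert\ge 1$ for all $c,d\in R$ with $cR+dR=R$ (this is a fundamental domain of $\Gamma$). A pairing transformation of $\mathcal{F}$ with respect to $\Gamma$ is an element $\gamma\in\Gamma\setminus\{1\}$ such that $\mathcal{F}\cap\gamma^{-1}(\mathcal{F})$ has dimension $3$, where the dimension is that of semi-algebraic sets: the dimension of $A\subseteq\mathbb{R}^4$ is the Krull dimension of $\mathbb{R}[X_1,\dots,X_4]/I(A)$, with $I(A)$ the ideal of the polynomials that vanish on $A$, and $\mathbb{H}^2\times\mathbb{H}^2$ is viewed in $\mathbb{R}^4$ through the coordinates $(x_1,x_2,y_1,y_2)$. **Theorem.** The group $\Gamma$ is generated by the pairing transformations of $\mathcal{F}$ with respect to $\Gamma$. -/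

import Mathlib

open scoped MatrixGroups UpperHalfPlane

noncomputable section

namespace HilbertModular

/-- `k₀ = 2` if `k ≡ 1 mod 4` and `k₀ = 1` otherwise. -/
def k₀ (k : ℕ) : ℕ := if k % 4 = 1 then 2 else 1

/-- `ω = (1 + √k) / k₀`. -/
def ω (k : ℕ) : ℝ := (1 + √(k : ℝ)) / (k₀ k : ℝ)

/-- The conjugate `ω' = (1 - √k) / k₀`. -/
def ω' (k : ℕ) : ℝ := (1 - √(k : ℝ)) / (k₀ k : ℝ)

/-- The integers `p`, `q` with `ω² = p + q ω` and `ω'² = p + q ω'`: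
`p = (k - 1) / k₀²` and `q = 2 / k₀`. -/
def p (k : ℕ) : ℤ := if k % 4 = 1 then ((k : ℤ) - 1) / 4 else (k : ℤ) - 1

/-- See `p`. -/
def q (k : ℕ) : ℤ := if k % 4 = 1 then 1 else 2

theorem ω_mul_self (k : ℕ) : ω k * ω k = p k • (1 : ℝ) + q k • ω k := by
  have hs : √(k : ℝ) * √(k : ℝ) = k := Real.mul_self_sqrt (Nat.cast_nonneg k)
  by_cases h : k % 4 = 1
  · have hp : ((((k : ℤ) - 1) / 4 : ℤ) : ℝ) = ((k : ℝ) - 1) / 4 := by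
      have h4 : (4 : ℤ) ∣ (k : ℤ) - 1 := by omega
      rw [Int.cast_div h4 (by norm_num)]
      push_cast
      ring
    simp only [ω, p, q, k₀, h, if_true, zsmul_eq_mul, hp]
    push_cast
    linear_combination hs / 4
  · simp only [ω, p, q, k₀, h, if_false, zsmul_eq_mul]
    push_cast
    linear_combination hs

theorem ω'_mul_self (k : ℕ) : ω' k * ω' k = p k • (1 : ℝ) + q k • ω' k := by
  have hs : √(k : ℝ) * √(k : ℝ) = k := Real.mul_self_sqrt (Nat.cast_nonneg k)
  by_cases h : k % 4 = 1
  · have hp : ((((k : ℤ) - 1) / 4 : ℤ) : ℝ) = ((k : ℝ) - 1) / 4 := by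
      have h4 : (4 : ℤ) ∣ (k : ℤ) - 1 := by omega
      rw [Int.cast_div h4 (by norm_num)]
      push_cast
      ring
    simp only [ω', p, q, k₀, h, if_true, zsmul_eq_mul, hp]
    push_cast
    linear_combination hs / 4
  · simp only [ω', p, q, k₀, h, if_false, zsmul_eq_mul]
    push_cast
    linear_combination hs

/-- The ring `R = ℤ[ω]`, with elements `α₀ + α₁ ω` for integers `α₀ = α.re`, `α₁ = α.im`,
multiplied by the rule `ω² = p + q ω`.  For `k` square-free and greater than `1` it is the ring of
integers of `ℚ(√k)`. -/
abbrev R (k : ℕ) : Type := QuadraticAlgebra ℤ (p k) (q k)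

/-- The inclusion `R → ℝ`, sending `α₀ + α₁ ω` to the real number `α₀ + α₁ ω`. -/
def val (k : ℕ) : R k →+* ℝ :=
  (QuadraticAlgebra.lift ⟨ω k, ω_mul_self k⟩ : R k →ₐ[ℤ] ℝ).toRingHom

/-- The conjugate embedding `α ↦ α'` of `R` in `ℝ`, sending `α₀ + α₁ ω` to `α₀ + α₁ ω'`. -/
def conj (k : ℕ) : R k →+* ℝ :=
  (QuadraticAlgebra.lift ⟨ω' k, ω'_mul_self k⟩ : R k →ₐ[ℤ] ℝ).toRingHom

theorem val_apply (k : ℕ) (α : R k) : val k α = α.re + α.im * ω k := by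
  simp [val, QuadraticAlgebra.lift]

theorem conj_apply (k : ℕ) (α : R k) : conj k α = α.re + α.im * ω' k := by
  simp [conj, QuadraticAlgebra.lift]

/-- The fundamental unit `ε₀`: the smallest unit of `R` that is greater than `1`. -/
def ε₀ (k : ℕ) : ℝ := sInf {x : ℝ | 1 < x ∧ ∃ u : (R k)ˣ, val k (u : R k) = x}

/-- The action of `SL₂(R)` on `ℍ × ℍ`: a matrix `A` acts as the pair `(A, A')`, each component
by Möbius transformations. -/
def slAction (k : ℕ) : SL(2, R k) →* Equiv.Perm (ℍ × ℍ) where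
  toFun A :=
    { toFun := fun Z =>
        (Matrix.SpecialLinearGroup.map (val k) A • Z.1,
          Matrix.SpecialLinearGroup.map (conj k) A • Z.2)
      invFun := fun Z =>
        ((Matrix.SpecialLinearGroup.map (val k) A)⁻¹ • Z.1,
          (Matrix.SpecialLinearGroup.map (conj k) A)⁻¹ • Z.2)
      left_inv := fun Z => by simp
      right_inv := fun Z => by simp }
  map_one' := by ext Z <;> simp
  map_mul' A B := by ext Z <;> simp [mul_smul]

/-- A central matrix of `SL₂` acts trivially on `ℍ`. -/
theorem map_center_smul {S : Type*} [CommRing S] (f : S →+* ℝ) {A : SL(2, S)}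
    (hA : A ∈ Subgroup.center SL(2, S)) (z : ℍ) :
    Matrix.SpecialLinearGroup.map f A • z = z := by
  obtain ⟨r, hr, hs⟩ := Matrix.SpecialLinearGroup.mem_center_iff.1 hA
  have h00 : A 0 0 = r := by rw [← hs]; simp
  have h01 : A 0 1 = 0 := by rw [← hs]; simp
  have h10 : A 1 0 = 0 := by rw [← hs]; simp
  have h11 : A 1 1 = r := by rw [← hs]; simp
  have hf : ((f r : ℝ) : ℂ) ≠ 0 := by
    have h2 : f r ^ 2 = 1 := by
      rw [← map_pow]
      simpa using congrArg f hr
    intro h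
    rw [Complex.ofReal_eq_zero] at h
    simp [h] at h2
  apply UpperHalfPlane.ext_re_im
  all_goals
    simp [← UpperHalfPlane.coe_re, ← UpperHalfPlane.coe_im,
      UpperHalfPlane.coe_specialLinearGroup_apply, h00, h01, h10, h11, hf]

/-- The Hilbert modular group `Γ = PSL₂(R)`. -/
abbrev Γ (k : ℕ) : Type := PSL(2, R k)

/-- The action of `Γ` on `ℍ × ℍ` induced by that of `SL₂(R)`. -/
def action (k : ℕ) : Γ k →* Equiv.Perm (ℍ × ℍ) :=
  QuotientGroup.lift _ (slAction k) fun A hA => by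
    ext Z : 1
    exact Prod.ext (map_center_smul (val k) hA Z.1) (map_center_smul (conj k) hA Z.2)

/-- For `Z = (x₁ + y₁ i, x₂ + y₂ i)`, the number
`‖c Z + d‖ = ((c x₁ + d)² + c² y₁²) ((c' x₂ + d')² + c'² y₂²)`. -/
def normCD (k : ℕ) (c d : R k) (Z : ℍ × ℍ) : ℝ :=
  ((val k c * Z.1.re + val k d) ^ 2 + val k c ^ 2 * Z.1.im ^ 2) *
    ((conj k c * Z.2.re + conj k d) ^ 2 + conj k c ^ 2 * Z.2.im ^ 2)

/-- The coordinate `s₁`; one has `x₁ = s₁ + s₂ ω` and `x₂ = s₁ + s₂ ω'`. -/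
def s₁ (k : ℕ) (Z : ℍ × ℍ) : ℝ := (ω' k * Z.1.re - ω k * Z.2.re) / (ω' k - ω k)

/-- The coordinate `s₂`; one has `x₁ = s₁ + s₂ ω` and `x₂ = s₁ + s₂ ω'`. -/
def s₂ (k : ℕ) (Z : ℍ × ℍ) : ℝ := (Z.1.re - Z.2.re) / (ω k - ω' k)

/-- The coordinate `r = y₁ / y₂`. -/
def ratio (Z : ℍ × ℍ) : ℝ := Z.1.im / Z.2.im

/-- The set `𝓕_∞`, given by `|s₁|, |s₂| ≤ 1/2` and `ε₀⁻² ≤ r ≤ ε₀²`. -/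
def FInfty (k : ℕ) : Set (ℍ × ℍ) :=
  {Z | |s₁ k Z| ≤ 1 / 2 ∧ |s₂ k Z| ≤ 1 / 2 ∧ (ε₀ k ^ 2)⁻¹ ≤ ratio Z ∧ ratio Z ≤ ε₀ k ^ 2}

/-- The set `𝓕₀` of all `Z` with `‖c Z + d‖ ≥ 1` for all `c, d ∈ R` with `c R + d R = R`. -/
def FZero (k : ℕ) : Set (ℍ × ℍ) :=
  {Z | ∀ c d : R k, Ideal.span {c} ⊔ Ideal.span {d} = ⊤ → 1 ≤ normCD k c d Z}

/-- The fundamental domain `𝓕 = 𝓕_∞ ∩ 𝓕₀` of `Γ`. -/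
def F (k : ℕ) : Set (ℍ × ℍ) := FInfty k ∩ FZero k

/-- The coordinates `(x₁, x₂, y₁, y₂) ∈ ℝ⁴` of `Z = (x₁ + y₁ i, x₂ + y₂ i)`. -/
def coords (Z : ℍ × ℍ) : Fin 4 → ℝ := ![Z.1.re, Z.2.re, Z.1.im, Z.2.im]

/-- The dimension of a real semi-algebraic set `A ⊆ ℝⁿ`, as in real algebraic geometry: the Krull
dimension of `ℝ[X₁, …, Xₙ] / I(A)`, where `I(A)` is the ideal of polynomials vanishing on `A`
(`⊥` if `A` is empty). -/
def semialgebraicDim {n : ℕ} (A : Set (Fin n → ℝ)) : WithBot ℕ∞ :=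
  ringKrullDim (MvPolynomial (Fin n) ℝ ⧸ MvPolynomial.vanishingIdeal ℝ A)

/-- `S_γ = 𝓕 ∩ γ⁻¹(𝓕)`. -/
def S (k : ℕ) (γ : Γ k) : Set (ℍ × ℍ) := F k ∩ action k γ⁻¹ '' F k

/-- A pairing transformation of `𝓕` with respect to `Γ`: some `γ ≠ 1` in `Γ` such that `S_γ` has
dimension `3`. -/
def IsPairing (k : ℕ) (γ : Γ k) : Prop :=
  γ ≠ 1 ∧ semialgebraicDim (coords '' S k γ) = 3

end HilbertModular

end

/-!
Let `Γ'` be the subgroup generated by the pairing transformations and suppose that some `γ ∈ Γ` does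
not lie in `Γ'`.  The translates `δ 𝓕` with `δ ∈ Γ'` and those with `δ ∉ Γ'` together cover `ℍ × ℍ`.
Join an interior point of `𝓕` to an interior point of `γ 𝓕` by a Euclidean segment in the convex
set `ℍ × ℍ ⊆ ℝ⁴`.  Only finitely many translates meet the segment and `𝓕` is closed, so by
connectedness some point of the segment lies in `δ 𝓕 ∩ δ' 𝓕` with `δ ∈ Γ'` and `δ' ∉ Γ'`.  Its
translate by `δ⁻¹` then lies in `S_η` for `η = δ'⁻¹ δ ∉ Γ'`, an element that is not a pairing
transformation.  The contradiction is that the segment can be chosen to avoid all translates of all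
such `S_η`.

* *Dimension.*  If `η ≠ 1`, a nonzero polynomial vanishes on `S_η`
  (`exists_polynomial_vanishing_on_S`), so `S_η` has dimension at most three, and at most two if `η`
  is not a pairing transformation.
* *Genericity.*  On a set of dimension at most two any three rational functions are algebraically
  dependent (`exists_eval_div_eq_zero_of_semialgebraicDim_lt`), because the transcendence degree of a
  finitely generated algebra is at most its Krull dimension
  (`AlgebraicIndependent.natCast_le_ringKrullDim`).  Applied to the composition of `δ` with a linear
  projection `ℝ⁴ → ℝ³` along the direction of the segment, this puts the parallel lines that meet
  `δ S_η` into a hypersurface of the parameter space `ℝ³` (`exists_polynomial_line_avoids`).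
  Countably many hypersurfaces do not contain an open set, so a small shift of the segment avoids
  every `δ S_η`.
* *Covering and finiteness.*  The height `y₁ y₂` is divided by `‖cZ + d‖` under the action, and the
  points of `𝓕` are the highest ones of their orbits, normalized by the stabilizer of `∞`.  Only
  finitely many group elements move a point of a compact box into `𝓕_∞` without lowering it
  (`finite_setOf_slAction_mem_FInfty`): the entries of such a matrix and their conjugates are bounded.
  This gives the local finiteness of the translates of `𝓕`, and also that they cover, since an orbit
  has a highest point (`exists_slAction_mem_F`).
-/

section

open MvPolynomial

/-! ### Krull dimension and algebraic dependence -/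

/-- In an integral extension with injective structure map every chain of primes lifts. -/
theorem ringKrullDim_le_of_isIntegral_of_injective {A B : Type*} [CommRing A] [CommRing B]
    [Algebra A B] [Algebra.IsIntegral A B] (h : Function.Injective (algebraMap A B)) :
    ringKrullDim A ≤ ringKrullDim B := by
  refine iSup_le fun l => ?_
  obtain ⟨P, -, hP, hP'⟩ := Ideal.exists_ideal_over_prime_of_isIntegral (S := B)
    l.head.asIdeal ⊥ (by
      rw [← RingHom.ker_eq_comap_bot, (RingHom.injective_iff_ker_eq_bot _).1 h]; exact bot_le)
  have : P.LiesOver l.head.asIdeal := ⟨hP'.symm⟩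
  obtain ⟨L, hL, -⟩ := Ideal.exists_ltSeries_of_hasGoingUp l P
  rw [← hL]
  exact le_iSup (fun l : LTSeries (PrimeSpectrum B) => (l.length : WithBot ℕ∞)) L

theorem ringKrullDim_le_of_isLocalization {A : Type*} (B : Type*) [CommRing A] [CommRing B]
    [Algebra A B] (M : Submonoid A) [IsLocalization M B] :
    ringKrullDim B ≤ ringKrullDim A :=
  Order.krullDim_le_of_strictMono (PrimeSpectrum.comap (algebraMap A B))
    (Monotone.strictMono_of_injective (fun _ _ hab => Ideal.comap_mono hab)
      (PrimeSpectrum.localization_comap_injective B M))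

/-- A finitely generated algebra over a field contains at most as many algebraically independent
elements as its Krull dimension.  After dividing by a prime lying over the zero ideal of the
polynomial subring, the algebra is a domain, and Noether normalization compares its Krull dimension
with its transcendence degree. -/
theorem AlgebraicIndependent.natCast_le_ringKrullDim {K : Type*} {C : Type*} [Field K] [CommRing C]
    [Algebra K C] [Algebra.FiniteType K C] {m : ℕ} {f : Fin m → C}
    (hf : AlgebraicIndependent K f) : (m : WithBot ℕ∞) ≤ ringKrullDim C := by
  obtain ⟨P, hP, hPc⟩ := Ideal.exists_comap_eq_of_mem_minimalPrimes_of_injective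
    (f := (aeval (R := K) f).toRingHom) hf ⊥ (by
      rw [IsDomain.minimalPrimes_eq_singleton_bot]; rfl)
  refine le_trans ?_ (ringKrullDim_quotient_le P)
  have hg : AlgebraicIndependent K (fun i => Ideal.Quotient.mkₐ K P (f i)) := by
    rw [AlgebraicIndependent, injective_iff_map_eq_zero]
    intro G hG
    have h2 : Ideal.Quotient.mkₐ K P (aeval f G) = 0 := by
      rw [← hG]
      exact congrArg (fun φ : MvPolynomial (Fin m) K →ₐ[K] (C ⧸ P) => φ G)
        (comp_aeval f (Ideal.Quotient.mkₐ K P))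
    have h3 : aeval f G ∈ P := Ideal.Quotient.eq_zero_iff_mem.1 h2
    have h4 : G ∈ P.comap (aeval (R := K) f).toRingHom := h3
    rw [hPc] at h4
    exact h4
  obtain ⟨s, g, hgi, hgint⟩ := exists_integral_inj_algHom_of_fg K (C ⧸ P)
  let _ := g.toRingHom.toAlgebra
  have : Algebra.IsIntegral (MvPolynomial (Fin s) K) (C ⧸ P) := ⟨hgint⟩
  have hs : (s : WithBot ℕ∞) ≤ ringKrullDim (C ⧸ P) := by
    have := ringKrullDim_le_of_isIntegral_of_injective
      (A := MvPolynomial (Fin s) K) (B := C ⧸ P) hgi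
    simpa using this
  refine le_trans ?_ hs
  have hrange : Algebra.adjoin K (Set.range (fun i => g (X i))) = g.range := by
    rw [Algebra.adjoin_range_eq_range_aeval]
    congr 1
    ext i
    simp
  have halg : Algebra.IsAlgebraic (Algebra.adjoin K (Set.range fun i => g (X i))) (C ⧸ P) := by
    rw [hrange]
    suffices h : Algebra.IsIntegral g.range (C ⧸ P) from h.isAlgebraic
    refine ⟨fun x => ?_⟩
    obtain ⟨p, hp, hpx⟩ := hgint x
    refine ⟨p.map g.rangeRestrict.toRingHom, hp.map _, ?_⟩
    rw [Polynomial.eval₂_map]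
    exact hpx
  have h1 := Algebra.IsAlgebraic.trdeg_le_cardinalMk (R := K) (A := C ⧸ P)
    (s := Set.range fun i => g (X i)) (alg := halg)
  have h2 := hg.lift_cardinalMk_le_trdeg
  have h3 := Cardinal.mk_range_le_lift (f := fun i : Fin s => g (X i))
  have h4 := h2.trans (Cardinal.lift_le.2 h1)
  rw [Cardinal.mk_fin, Cardinal.lift_natCast] at h4
  rw [Cardinal.mk_fin, Cardinal.lift_natCast, Cardinal.lift_uzero] at h3
  have h5 : m ≤ s := by
    have := h4.trans (Cardinal.lift_le.2 h3)
    simpa using this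
  exact_mod_cast h5

/-- Rational functions with a common denominator restrict to algebraically dependent functions on a
set whose dimension is less than their number. -/
theorem HilbertModular.exists_eval_div_eq_zero_of_semialgebraicDim_lt {n m : ℕ}
    {A : Set (Fin n → ℝ)} (hA : semialgebraicDim A < m) (D : MvPolynomial (Fin n) ℝ)
    (hD : ∀ a ∈ A, eval a D ≠ 0) (N : Fin m → MvPolynomial (Fin n) ℝ) :
    ∃ G : MvPolynomial (Fin m) ℝ, G ≠ 0 ∧
      ∀ a ∈ A, eval (fun i => eval a (N i) / eval a D) G = 0 := by
  let B := MvPolynomial (Fin n) ℝ ⧸ vanishingIdeal ℝ A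
  let d : B := Ideal.Quotient.mk _ D
  let C := Localization.Away d
  have : Algebra.FiniteType B C := inferInstance
  have : Algebra.FiniteType ℝ C := Algebra.FiniteType.trans (S := B) inferInstance inferInstance
  let f : Fin m → C := fun i =>
    algebraMap B C (Ideal.Quotient.mk _ (N i)) * IsLocalization.Away.invSelf d
  have hf : ¬ AlgebraicIndependent ℝ f := by
    intro h
    exact absurd (h.natCast_le_ringKrullDim.trans
      (ringKrullDim_le_of_isLocalization C (Submonoid.powers d))) (not_le_of_gt hA)
  rw [AlgebraicIndependent, injective_iff_map_eq_zero] at hf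
  push Not at hf
  obtain ⟨G, hG, hG0⟩ := hf
  refine ⟨G, hG0, fun a ha => ?_⟩
  -- evaluation at a point of `A` factors through `B`, and through `C` since `D` does not vanish there
  let evB : B →ₐ[ℝ] ℝ := Ideal.Quotient.liftₐ _ (aeval a) fun p hp => by
    simpa using (mem_vanishingIdeal_iff.1 hp) a ha
  have hevB (p : MvPolynomial (Fin n) ℝ) : evB (Ideal.Quotient.mk _ p) = eval a p := by
    change aeval a p = _
    rw [aeval_eq_eval]
  have hu : IsUnit (evB d) := by
    rw [hevB]; exact (hD a ha).isUnit
  let evC : C →+* ℝ := IsLocalization.Away.lift d (g := evB.toRingHom) hu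
  have hevC (b : B) : evC (algebraMap B C b) = evB b := IsLocalization.Away.lift_eq d hu b
  let evC' : C →ₐ[ℝ] ℝ := { evC with
    commutes' := fun r => by
      change evC (algebraMap ℝ C r) = _
      rw [IsScalarTower.algebraMap_apply ℝ B C, hevC]
      simp }
  have hinv : evC (IsLocalization.Away.invSelf d) = (eval a D)⁻¹ := by
    have h1 := congrArg evC (IsLocalization.Away.mul_invSelf (S := C) d)
    rw [map_mul, hevC, hevB, map_one] at h1
    exact eq_inv_of_mul_eq_one_right h1
  have h2 := congrArg evC' hG
  rw [map_zero, ← AlgHom.comp_apply, comp_aeval] at h2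
  rw [← h2, aeval_eq_eval]
  change _ = eval _ G
  congr 2
  ext i
  change _ = evC (f i)
  simp only [f, map_mul, hevC, hevB, hinv, div_eq_mul_inv]

/-- A set on which some nonzero polynomial vanishes has positive codimension. -/
theorem HilbertModular.semialgebraicDim_le_of_eval_eq_zero {n : ℕ} {A : Set (Fin (n + 1) → ℝ)}
    {P : MvPolynomial (Fin (n + 1)) ℝ} (hP : P ≠ 0) (hPA : ∀ a ∈ A, eval a P = 0) :
    semialgebraicDim A ≤ n := by
  have h1 : semialgebraicDim A ≤
      ringKrullDim (MvPolynomial (Fin (n + 1)) ℝ ⧸ Ideal.span {P}) := by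
    refine ringKrullDim_le_of_surjective (Ideal.Quotient.factor (?_ : _ ≤ _))
      (Ideal.Quotient.factor_surjective _)
    rw [Ideal.span_singleton_le_iff_mem, mem_vanishingIdeal_iff]
    simpa using hPA
  have h2 := ringKrullDim_quotient_succ_le_of_nonZeroDivisor (mem_nonZeroDivisors_of_ne_zero hP)
  rw [MvPolynomial.ringKrullDim_of_isNoetherianRing, ringKrullDim_eq_zero_of_field, zero_add,
    Nat.card_fin, Nat.cast_add, Nat.cast_one] at h2
  exact h1.trans (ENat.WithBot.add_le_add_one_right_iff.1 h2)

/-! ### Points avoiding countably many hypersurfaces -/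

/-- A polynomial vanishing on a box with infinite sides is zero. -/
theorem MvPolynomial.dense_setOf_eval_ne_zero {m : ℕ} {G : MvPolynomial (Fin m) ℝ} (hG : G ≠ 0) :
    Dense {w : Fin m → ℝ | eval w G ≠ 0} := by
  intro w
  rw [mem_closure_iff_nhds_basis (nhds_basis_uniformity Metric.uniformity_basis_dist)]
  intro ε hε
  by_contra! hcon
  apply hG
  refine funext_set (fun i => Metric.ball (w i) ε) (fun i => ?_) fun y hy => ?_
  · rw [Real.ball_eq_Ioo]
    exact Set.Ioo_infinite (by linarith)
  · have := hcon y
    rw [map_zero]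
    by_contra h
    refine absurd (this h) (not_not.2 ?_)
    change dist y w < ε
    rw [dist_pi_lt_iff hε]
    exact fun i => hy i trivial

/-- Countably many nonzero polynomials are simultaneously nonzero on a dense set. -/
theorem MvPolynomial.dense_setOf_forall_eval_ne_zero {m : ℕ} {ι : Type*} [Countable ι]
    {G : ι → MvPolynomial (Fin m) ℝ} (hG : ∀ i, G i ≠ 0) :
    Dense {w : Fin m → ℝ | ∀ i, eval w (G i) ≠ 0} := by
  rw [Set.ofPred_forall]
  exact dense_iInter_of_isOpen
    (fun i => isOpen_ne_fun (MvPolynomial.continuous_eval _) continuous_const)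
    fun i => dense_setOf_eval_ne_zero (hG i)

end

namespace HilbertModular

open MvPolynomial

/-! ### Norms and units of `R` -/

theorem k₀_pos (k : ℕ) : (0 : ℝ) < k₀ k := by
  unfold k₀; split_ifs <;> norm_num

theorem ω_add_ω' (k : ℕ) : ω k + ω' k = q k := by
  unfold ω ω' q k₀
  split_ifs <;> push_cast <;> ring

theorem ω_mul_ω' (k : ℕ) : ω k * ω' k = -p k := by
  have h1 := ω_mul_self k
  have h2 := ω_add_ω' k
  rw [zsmul_eq_mul, zsmul_eq_mul, ← h2] at h1
  linear_combination -h1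

theorem ω_sub_ω' (k : ℕ) : ω k - ω' k = 2 * √k / k₀ k := by
  unfold ω ω'; ring

theorem ω_sub_ω'_pos {k : ℕ} (hk1 : 1 < k) : 0 < ω k - ω' k := by
  rw [ω_sub_ω']
  have := k₀_pos k
  have : 0 < √(k : ℝ) := Real.sqrt_pos.2 (by exact_mod_cast (by omega : 0 < k))
  positivity

theorem val_mul_conj (k : ℕ) (α : R k) : val k α * conj k α = (α.norm : ℤ) := by
  rw [val_apply, conj_apply, QuadraticAlgebra.norm_def]
  push_cast
  linear_combination (α.re * α.im : ℝ) * ω_add_ω' k + (α.im * α.im : ℝ) * ω_mul_ω' k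

theorem not_isSquare_of_squarefree {k : ℕ} (hk : Squarefree k) (hk1 : 1 < k) : ¬ IsSquare k := by
  rintro ⟨r, hr⟩
  have := Nat.isUnit_iff.1 (hk r ⟨1, by rw [hr, mul_one]⟩)
  subst this
  omega

theorem eq_zero_of_val_mul_conj_eq_zero {k : ℕ} (hk : Squarefree k) (hk1 : 1 < k) {α : R k}
    (h : val k α * conj k α = 0) : α = 0 := by
  have hirr : Irrational √(k : ℝ) :=
    irrational_sqrt_natCast_iff.2 (not_isSquare_of_squarefree hk hk1)
  have hk0 := k₀_pos k
  have him : α.im = 0 := by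
    by_contra him
    have him' : (α.im : ℝ) ≠ 0 := by exact_mod_cast him
    rcases mul_eq_zero.1 h with h | h
    · rw [val_apply, ω] at h
      refine hirr ⟨-(α.re * k₀ k + α.im) / α.im, ?_⟩
      push_cast
      field_simp at h ⊢
      linear_combination -h
    · rw [conj_apply, ω'] at h
      refine hirr ⟨(α.re * k₀ k + α.im) / α.im, ?_⟩
      push_cast
      field_simp at h ⊢
      linear_combination h
  have hre : α.re = 0 := by
    rw [val_apply, conj_apply, him] at h
    simpa using h
  exact QuadraticAlgebra.ext hre him

/-- The norm of a nonzero element of `R` is a nonzero integer. -/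
theorem one_le_abs_val_mul_abs_conj {k : ℕ} (hk : Squarefree k) (hk1 : 1 < k) {α : R k}
    (hα : α ≠ 0) : 1 ≤ |val k α| * |conj k α| := by
  rw [← abs_mul]
  have h : val k α * conj k α ≠ 0 := fun h => hα (eq_zero_of_val_mul_conj_eq_zero hk hk1 h)
  rw [val_mul_conj] at h ⊢
  rw [← Int.cast_abs]
  exact_mod_cast Int.one_le_abs (by exact_mod_cast h)

theorem one_le_sq_val_mul_sq_conj {k : ℕ} (hk : Squarefree k) (hk1 : 1 < k) {α : R k}
    (hα : α ≠ 0) : 1 ≤ val k α ^ 2 * conj k α ^ 2 := by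
  have := one_le_abs_val_mul_abs_conj hk hk1 hα
  rw [← sq_abs (val k α), ← sq_abs (conj k α), ← mul_pow]
  exact one_le_pow₀ this

theorem val_ne_zero {k : ℕ} (hk : Squarefree k) (hk1 : 1 < k) {α : R k} (hα : α ≠ 0) :
    val k α ≠ 0 := fun h => hα (eq_zero_of_val_mul_conj_eq_zero hk hk1 (by rw [h, zero_mul]))

theorem val_injective {k : ℕ} (hk : Squarefree k) (hk1 : 1 < k) :
    Function.Injective (val k) :=
  (injective_iff_map_eq_zero _).2 fun α h => by
    by_contra hα
    exact val_ne_zero hk hk1 hα h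

theorem abs_val_mul_abs_conj_of_mul_eq_one {k : ℕ} (hk : Squarefree k) (hk1 : 1 < k) {α β : R k}
    (h : α * β = 1) : |val k α| * |conj k α| = 1 := by
  have hα : α ≠ 0 := by rintro rfl; simp at h
  have hβ : β ≠ 0 := by rintro rfl; simp at h
  have h1 := one_le_abs_val_mul_abs_conj hk hk1 hα
  have h2 := one_le_abs_val_mul_abs_conj hk hk1 hβ
  have h3 : (|val k α| * |conj k α|) * (|val k β| * |conj k β|) = 1 := by
    have e1 : |val k α| * |val k β| = 1 := by rw [← abs_mul, ← map_mul, h]; simp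
    have e2 : |conj k α| * |conj k β| = 1 := by rw [← abs_mul, ← map_mul, h]; simp
    linear_combination |conj k α| * |conj k β| * e1 + e2
  nlinarith

theorem finite_setOf_abs_le {k : ℕ} (hk1 : 1 < k) (C : ℝ) :
    {α : R k | |val k α| ≤ C ∧ |conj k α| ≤ C}.Finite := by
  have hd := ω_sub_ω'_pos hk1
  set M := (2 * C) / (ω k - ω' k) with hM
  set N := C + M * |ω k|
  refine Set.Finite.subset (((Set.finite_Icc (-⌊N⌋) ⌊N⌋).prod
    (Set.finite_Icc (-⌊M⌋) ⌊M⌋)).image fun x : ℤ × ℤ => (⟨x.1, x.2⟩ : R k)) ?_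
  rintro α ⟨h1, h2⟩
  have him : |(α.im : ℝ)| ≤ M := by
    rw [hM, le_div_iff₀ hd, ← abs_of_pos hd, ← abs_mul]
    have : (α.im : ℝ) * (ω k - ω' k) = val k α - conj k α := by
      rw [val_apply, conj_apply]; ring
    rw [this]
    have := abs_sub (val k α) (conj k α)
    linarith
  have hre : |(α.re : ℝ)| ≤ N := by
    have : (α.re : ℝ) = val k α - α.im * ω k := by rw [val_apply]; ring
    rw [this]
    refine (abs_sub _ _).trans ?_
    rw [abs_mul]
    exact add_le_add h1 (mul_le_mul_of_nonneg_right him (abs_nonneg _))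
  have aux : ∀ (n : ℤ) (T : ℝ), |(n : ℝ)| ≤ T → n ∈ Set.Icc (-⌊T⌋) ⌊T⌋ := fun n T h => by
    rw [← Int.cast_abs] at h
    have := Int.le_floor.2 h
    exact abs_le.1 this
  exact ⟨(α.re, α.im), ⟨aux _ _ hre, aux _ _ him⟩, rfl⟩

/-- Pell's equation provides a unit greater than one. -/
theorem exists_unit_one_lt_val {k : ℕ} (hk : Squarefree k) (hk1 : 1 < k) :
    ∃ u : (R k)ˣ, 1 < val k u := by
  have hns : ¬ IsSquare (k : ℤ) := by
    rw [Int.isSquare_natCast_iff]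
    exact not_isSquare_of_squarefree hk hk1
  obtain ⟨x, y, hxy, hy⟩ := Pell.exists_of_not_isSquare (by exact_mod_cast (by omega : 0 < k)) hns
  have hx : x ≠ 0 := by
    rintro rfl
    nlinarith [sq_nonneg y, (by exact_mod_cast (by omega : 0 < k) : (0 : ℤ) < k)]
  have hs : √(k : ℝ) * √(k : ℝ) = k := Real.mul_self_sqrt (Nat.cast_nonneg k)
  have hk0 := k₀_pos k
  -- `√k = k₀ ω - 1` and `-√k = k₀ ω' - 1`
  let α : R k := ⟨|x| - |y|, k₀ k * |y|⟩
  have hv : val k α = |x| + |y| * √k := by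
    rw [val_apply, ω]
    simp only [α]
    push_cast
    field_simp
    ring
  have hc : conj k α = |x| - |y| * √k := by
    rw [conj_apply, ω']
    simp only [α]
    push_cast
    field_simp
    ring
  have hn : α.norm = 1 := by
    have h1 := val_mul_conj k α
    have h2 : (x : ℝ) ^ 2 - k * (y : ℝ) ^ 2 = 1 := by exact_mod_cast hxy
    have h3 : (α.norm : ℝ) = 1 := by
      rw [← h1, hv, hc, ← h2, ← sq_abs (x : ℝ), ← sq_abs (y : ℝ)]
      push_cast
      linear_combination -(|(y : ℝ)| ^ 2) * hs
    exact_mod_cast h3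
  have hu : IsUnit α := by
    rw [QuadraticAlgebra.isUnit_iff_norm_isUnit, hn]
    exact isUnit_one
  refine ⟨hu.unit, ?_⟩
  rw [IsUnit.unit_spec, hv, Int.cast_abs, Int.cast_abs]
  have h1 : (1 : ℝ) ≤ |(x : ℝ)| := by
    rw [← Int.cast_abs]; exact_mod_cast Int.one_le_abs hx
  have h2 : (1 : ℝ) ≤ |(y : ℝ)| := by
    rw [← Int.cast_abs]; exact_mod_cast Int.one_le_abs hy
  have h3 : 0 < √(k : ℝ) := Real.sqrt_pos.2 (by exact_mod_cast (by omega : 0 < k))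
  nlinarith

/-- The infimum defining the fundamental unit is attained: the units in a bounded interval to the
right of `1` have bounded conjugates, so they are finite in number. -/
theorem exists_unit_val_eq_ε₀ {k : ℕ} (hk : Squarefree k) (hk1 : 1 < k) :
    1 < ε₀ k ∧ (∃ u : (R k)ˣ, val k u = ε₀ k) ∧ ∀ u : (R k)ˣ, 1 < val k u → ε₀ k ≤ val k u := by
  set T : Set ℝ := {x : ℝ | 1 < x ∧ ∃ u : (R k)ˣ, val k (u : R k) = x} with hT
  obtain ⟨u₀, hu₀⟩ := exists_unit_one_lt_val hk hk1
  set C := val k u₀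
  have hfin : (T ∩ Set.Iic C).Finite := by
    refine ((finite_setOf_abs_le hk1 C).image (val k)).subset ?_
    rintro x ⟨⟨hx, u, rfl⟩, hxC⟩
    refine ⟨u, ⟨?_, ?_⟩, rfl⟩
    · rw [abs_of_pos (by linarith)]; exact hxC
    · have := abs_val_mul_abs_conj_of_mul_eq_one hk hk1 u.mul_inv
      rw [abs_of_pos (by linarith)] at this
      nlinarith [abs_nonneg (conj k u)]
  obtain ⟨x, ⟨hxT, hxC⟩, hmin⟩ := Set.exists_min_image _ id hfin ⟨C, ⟨hu₀, u₀, rfl⟩, le_refl C⟩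
  have hleast : IsLeast T x := by
    refine ⟨hxT, fun y hy => ?_⟩
    by_cases hyC : y ≤ C
    · exact hmin y ⟨hy, hyC⟩
    · exact hxC.trans (le_of_not_ge hyC)
  have hε : ε₀ k = x := hleast.csInf_eq
  rw [hε]
  exact ⟨hxT.1, hxT.2, fun u hu => hleast.2 ⟨hu, u, rfl⟩⟩

/-! ### The action in coordinates -/

/-- The squared absolute value `|c z + d|²`. -/
def absSq (c d : ℝ) (z : ℍ) : ℝ := (c * z.re + d) ^ 2 + c ^ 2 * z.im ^ 2

theorem normCD_eq (k : ℕ) (c d : R k) (Z : ℍ × ℍ) :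
    normCD k c d Z = absSq (val k c) (val k d) Z.1 * absSq (conj k c) (conj k d) Z.2 := rfl

theorem absSq_nonneg (c d : ℝ) (z : ℍ) : 0 ≤ absSq c d z := by
  unfold absSq; positivity

theorem sq_mul_sq_im_le_absSq (c d : ℝ) (z : ℍ) : c ^ 2 * z.im ^ 2 ≤ absSq c d z := by
  unfold absSq; nlinarith [sq_nonneg (c * z.re + d)]

theorem absSq_zero (d : ℝ) (z : ℍ) : absSq 0 d z = d ^ 2 := by
  simp [absSq]

theorem normSq_eq_absSq (c d : ℝ) (z : ℍ) : Complex.normSq ((c : ℂ) * z + d) = absSq c d z := by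
  rw [Complex.normSq_apply, absSq]
  simp
  ring

theorem absSq_pos (g : SL(2, ℝ)) (z : ℍ) : 0 < absSq (g 1 0) (g 1 1) z := by
  refine lt_of_le_of_ne (absSq_nonneg _ _ _) fun h => ?_
  have hdet := g.det_coe
  rw [Matrix.det_fin_two] at hdet
  have him := z.im_pos
  unfold absSq at h
  have h1 : g 1 0 * z.im = 0 := by
    apply pow_eq_zero_iff (two_ne_zero) |>.1
    nlinarith [sq_nonneg (g 1 0 * z.re + g 1 1), sq_nonneg (g 1 0 * z.im)]
  have hc : g 1 0 = 0 := by
    rcases mul_eq_zero.1 h1 with h | h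
    · exact h
    · exact absurd h him.ne'
  rw [hc] at h hdet
  have hd : g 1 1 = 0 := by
    apply pow_eq_zero_iff (two_ne_zero) |>.1
    nlinarith
  rw [hd] at hdet
  norm_num at hdet

theorem coe_smul_eq (g : SL(2, ℝ)) (z : ℍ) :
    ((g • z : ℍ) : ℂ) = ((g 0 0 : ℂ) * z + g 0 1) / ((g 1 0 : ℂ) * z + g 1 1) := by
  rw [UpperHalfPlane.coe_specialLinearGroup_apply]
  rfl

theorem im_smul_eq (g : SL(2, ℝ)) (z : ℍ) :
    (g • z).im = z.im / absSq (g 1 0) (g 1 1) z := by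
  have hdet := g.det_coe
  rw [Matrix.det_fin_two] at hdet
  rw [← UpperHalfPlane.coe_im, coe_smul_eq, Complex.div_im, normSq_eq_absSq]
  simp only [Complex.add_im, Complex.add_re, Complex.mul_im, Complex.mul_re, Complex.ofReal_re,
    Complex.ofReal_im, UpperHalfPlane.coe_re, UpperHalfPlane.coe_im]
  rw [← sub_div]
  congr 1
  linear_combination z.im * hdet

theorem re_smul_eq (g : SL(2, ℝ)) (z : ℍ) :
    (g • z).re = ((g 0 0 * z.re + g 0 1) * (g 1 0 * z.re + g 1 1) + g 0 0 * g 1 0 * z.im ^ 2) /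
      absSq (g 1 0) (g 1 1) z := by
  rw [← UpperHalfPlane.coe_re, coe_smul_eq, Complex.div_re, normSq_eq_absSq]
  simp only [Complex.add_im, Complex.add_re, Complex.mul_im, Complex.mul_re, Complex.ofReal_re,
    Complex.ofReal_im, UpperHalfPlane.coe_re, UpperHalfPlane.coe_im]
  rw [← add_div]
  congr 1
  ring

/-- The height `y₁ y₂`. -/
def height (Z : ℍ × ℍ) : ℝ := Z.1.im * Z.2.im

theorem height_pos (Z : ℍ × ℍ) : 0 < height Z := mul_pos Z.1.im_pos Z.2.im_pos

theorem normCD_pos {k : ℕ} (A : SL(2, R k)) (Z : ℍ × ℍ) : 0 < normCD k (A 1 0) (A 1 1) Z :=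
  mul_pos (absSq_pos (Matrix.SpecialLinearGroup.map (val k) A) Z.1)
    (absSq_pos (Matrix.SpecialLinearGroup.map (conj k) A) Z.2)

theorem im_fst_slAction {k : ℕ} (A : SL(2, R k)) (Z : ℍ × ℍ) :
    (slAction k A Z).1.im = Z.1.im / absSq (val k (A 1 0)) (val k (A 1 1)) Z.1 :=
  im_smul_eq (Matrix.SpecialLinearGroup.map (val k) A) Z.1

theorem im_snd_slAction {k : ℕ} (A : SL(2, R k)) (Z : ℍ × ℍ) :
    (slAction k A Z).2.im = Z.2.im / absSq (conj k (A 1 0)) (conj k (A 1 1)) Z.2 :=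
  im_smul_eq (Matrix.SpecialLinearGroup.map (conj k) A) Z.2

theorem re_fst_slAction {k : ℕ} (A : SL(2, R k)) (Z : ℍ × ℍ) :
    (slAction k A Z).1.re = ((val k (A 0 0) * Z.1.re + val k (A 0 1)) *
      (val k (A 1 0) * Z.1.re + val k (A 1 1)) + val k (A 0 0) * val k (A 1 0) * Z.1.im ^ 2) /
      absSq (val k (A 1 0)) (val k (A 1 1)) Z.1 :=
  re_smul_eq (Matrix.SpecialLinearGroup.map (val k) A) Z.1

theorem re_snd_slAction {k : ℕ} (A : SL(2, R k)) (Z : ℍ × ℍ) :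
    (slAction k A Z).2.re = ((conj k (A 0 0) * Z.2.re + conj k (A 0 1)) *
      (conj k (A 1 0) * Z.2.re + conj k (A 1 1)) + conj k (A 0 0) * conj k (A 1 0) * Z.2.im ^ 2) /
      absSq (conj k (A 1 0)) (conj k (A 1 1)) Z.2 :=
  re_smul_eq (Matrix.SpecialLinearGroup.map (conj k) A) Z.2

theorem height_slAction {k : ℕ} (A : SL(2, R k)) (Z : ℍ × ℍ) :
    height (slAction k A Z) = height Z / normCD k (A 1 0) (A 1 1) Z := by
  rw [height, im_fst_slAction, im_snd_slAction, normCD_eq, height, div_mul_div_comm]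

theorem span_bottom_row_eq_top {k : ℕ} (A : SL(2, R k)) :
    Ideal.span {A 1 0} ⊔ Ideal.span {A 1 1} = ⊤ := by
  have hdet := A.det_coe
  rw [Matrix.det_fin_two] at hdet
  rw [Ideal.eq_top_iff_one, Ideal.mem_span_singleton_sup]
  exact ⟨-A 0 1, A 0 0 * A 1 1, Ideal.mul_mem_left _ _ (Ideal.mem_span_singleton_self _), by
    linear_combination hdet⟩

/-- A point of `𝓕₀` has the largest height in its orbit. -/
theorem height_slAction_le {k : ℕ} (A : SL(2, R k)) {Z : ℍ × ℍ} (hZ : Z ∈ FZero k) :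
    height (slAction k A Z) ≤ height Z := by
  rw [height_slAction]
  exact div_le_self (height_pos Z).le (hZ _ _ (span_bottom_row_eq_top A))

/-- If `Z` and `A Z` both lie in `𝓕₀`, they have the same height. -/
theorem normCD_eq_one {k : ℕ} (A : SL(2, R k)) {Z : ℍ × ℍ} (hZ : Z ∈ FZero k)
    (hAZ : slAction k A Z ∈ FZero k) : normCD k (A 1 0) (A 1 1) Z = 1 := by
  have h1 := height_slAction_le A⁻¹ hAZ
  rw [← Equiv.Perm.mul_apply, ← map_mul, inv_mul_cancel, map_one, Equiv.Perm.one_apply,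
    height_slAction] at h1
  have h2 := normCD_pos A Z
  rw [le_div_iff₀ h2] at h1
  have h3 := hZ _ _ (span_bottom_row_eq_top A)
  nlinarith [height_pos Z]

theorem mem_S_mk {k : ℕ} (A : SL(2, R k)) (Z : ℍ × ℍ) :
    Z ∈ S k (QuotientGroup.mk A) ↔ Z ∈ F k ∧ slAction k A Z ∈ F k := by
  refine and_congr Iff.rfl ?_
  rw [map_inv]
  constructor
  · rintro ⟨W, hW, rfl⟩
    change (action k (QuotientGroup.mk A)) ((action k (QuotientGroup.mk A))⁻¹ W) ∈ _
    exact ((action k (QuotientGroup.mk A)).apply_symm_apply W).symm ▸ hW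
  · intro h
    exact ⟨_, h, (action k (QuotientGroup.mk A)).symm_apply_apply Z⟩

/-! ### A nonzero polynomial vanishing on `S_γ` -/

theorem s₁_add {k : ℕ} (hk1 : 1 < k) (β : R k) {Z W : ℍ × ℍ}
    (h1 : W.1.re = Z.1.re + val k β) (h2 : W.2.re = Z.2.re + conj k β) :
    s₁ k W = s₁ k Z + β.re := by
  have : ω' k - ω k ≠ 0 := by have := ω_sub_ω'_pos hk1; linarith
  rw [s₁, s₁, h1, h2, val_apply, conj_apply]
  field_simp
  ring

theorem s₂_add {k : ℕ} (hk1 : 1 < k) (β : R k) {Z W : ℍ × ℍ}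
    (h1 : W.1.re = Z.1.re + val k β) (h2 : W.2.re = Z.2.re + conj k β) :
    s₂ k W = s₂ k Z + β.im := by
  have : ω k - ω' k ≠ 0 := (ω_sub_ω'_pos hk1).ne'
  rw [s₂, s₂, h1, h2, val_apply, conj_apply]
  field_simp
  ring

/-- If `s` and `s + n` lie in `[-1/2, 1/2]` for an integer `n ≠ 0`, then `s` is an endpoint. -/
theorem sq_eq_of_abs_le_of_abs_add_le {s : ℝ} {n : ℤ} (hn : n ≠ 0) (h1 : |s| ≤ 1 / 2)
    (h2 : |s + n| ≤ 1 / 2) : s ^ 2 = 1 / 4 := by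
  rw [abs_le] at h1 h2
  rcases lt_or_gt_of_ne hn with h | h
  · have : (n : ℝ) ≤ -1 := by exact_mod_cast (by omega : n ≤ -1)
    have : s = 1 / 2 := by linarith
    rw [this]; norm_num
  · have : (1 : ℝ) ≤ n := by exact_mod_cast (by omega : 1 ≤ n)
    have : s = -(1 / 2) := by linarith
    rw [this]; norm_num

theorem exists_polynomial_normCD {k : ℕ} (hk : Squarefree k) (hk1 : 1 < k) {c : R k} (d : R k)
    (hc : c ≠ 0) : ∃ P : MvPolynomial (Fin 4) ℝ, P ≠ 0 ∧
      ∀ Z, normCD k c d Z = 1 → eval (coords Z) P = 0 := by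
  let P : MvPolynomial (Fin 4) ℝ :=
    ((C (val k c) * X 0 + C (val k d)) ^ 2 + C (val k c) ^ 2 * X 2 ^ 2) *
      ((C (conj k c) * X 1 + C (conj k d)) ^ 2 + C (conj k c) ^ 2 * X 3 ^ 2) - 1
  refine ⟨P, fun h => ?_, fun Z hZ => ?_⟩
  · -- at `x₁ = x₂ = 0`, `y₁ = y₂ = 2` the value is at least `16 c² c'² - 1 > 0`
    have h1 := congrArg (eval ![0, 0, 2, 2]) h
    simp [P] at h1
    have h2 := one_le_sq_val_mul_sq_conj hk hk1 hc
    nlinarith [sq_nonneg (val k d * conj k c), sq_nonneg (val k c * conj k d),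
      sq_nonneg (val k d * conj k d)]
  · rw [normCD] at hZ
    simp [P, coords, hZ]

theorem exists_polynomial_ratio (k : ℕ) : ∃ P : MvPolynomial (Fin 4) ℝ, P ≠ 0 ∧
    ∀ Z, ratio Z = ε₀ k ^ 2 ∨ ratio Z = (ε₀ k ^ 2)⁻¹ → eval (coords Z) P = 0 := by
  refine ⟨(X 2 - C (ε₀ k ^ 2) * X 3) * (X 2 - C (ε₀ k ^ 2)⁻¹ * X 3), fun h => ?_, fun Z hZ => ?_⟩
  · have h1 := congrArg (eval ![0, 0, 1, 0]) h
    simp at h1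
  · have h2 : Z.1.im = ratio Z * Z.2.im := by
      rw [ratio, div_mul_cancel₀ _ Z.2.im_pos.ne']
    simp only [map_mul, map_sub, eval_X, eval_C, coords]
    simp only [Matrix.cons_val]
    rw [h2]
    rcases hZ with hZ | hZ
    · rw [hZ]; ring
    · rw [hZ]; ring

theorem exists_polynomial_s₁ (k : ℕ) : ∃ P : MvPolynomial (Fin 4) ℝ, P ≠ 0 ∧
    ∀ Z, s₁ k Z ^ 2 = 1 / 4 → eval (coords Z) P = 0 := by
  refine ⟨(C ((ω' k - ω k)⁻¹) * (C (ω' k) * X 0 - C (ω k) * X 1)) ^ 2 - C (1 / 4),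
    fun h => ?_, fun Z hZ => ?_⟩
  · have h1 := congrArg (eval ![0, 0, 0, 0]) h
    simp at h1
  · rw [s₁] at hZ
    simp only [map_mul, map_sub, map_pow, eval_X, eval_C, coords]
    simp only [Matrix.cons_val]
    rw [← hZ]
    ring

theorem exists_polynomial_s₂ (k : ℕ) : ∃ P : MvPolynomial (Fin 4) ℝ, P ≠ 0 ∧
    ∀ Z, s₂ k Z ^ 2 = 1 / 4 → eval (coords Z) P = 0 := by
  refine ⟨(C ((ω k - ω' k)⁻¹) * (X 0 - X 1)) ^ 2 - C (1 / 4), fun h => ?_, fun Z hZ => ?_⟩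
  · have h1 := congrArg (eval ![0, 0, 0, 0]) h
    simp at h1
  · rw [s₂] at hZ
    simp only [map_mul, map_sub, map_pow, eval_X, eval_C, coords]
    simp only [Matrix.cons_val]
    rw [← hZ]
    ring

theorem ratio_slAction_of_eq_zero {k : ℕ} (hk : Squarefree k) (hk1 : 1 < k) (A : SL(2, R k))
    (hc : A 1 0 = 0) (Z : ℍ × ℍ) :
    ratio (slAction k A Z) * val k (A 1 1) ^ 4 = ratio Z := by
  have hdet := A.det_coe
  rw [Matrix.det_fin_two, hc, mul_zero, sub_zero, mul_comm] at hdet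
  have h1 := abs_val_mul_abs_conj_of_mul_eq_one hk hk1 hdet
  have hv : val k (A 1 1) ≠ 0 := by
    intro h; simp [h] at h1
  have hv' : conj k (A 1 1) ≠ 0 := by
    intro h; simp [h] at h1
  have h2 : val k (A 1 1) ^ 2 * conj k (A 1 1) ^ 2 = 1 := by
    rw [← sq_abs (val _ _), ← sq_abs (conj _ _), ← mul_pow, h1, one_pow]
  rw [ratio, im_fst_slAction, im_snd_slAction, hc, map_zero, map_zero, absSq_zero, absSq_zero,
    ratio]
  have := Z.2.im_pos.ne'
  field_simp
  linear_combination h2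

/-- Some nonzero polynomial vanishes on `S_γ` if `γ ≠ 1`: a point of `S_γ` satisfies `‖cZ + d‖ = 1`
if `c ≠ 0`, lies over an end of the interval of ratios if `γ` fixes `∞` and is not a translation,
and over a side of the square of `(s₁, s₂)` if it is one. -/
theorem exists_polynomial_vanishing_on_S {k : ℕ} (hk : Squarefree k) (hk1 : 1 < k)
    {γ : Γ k} (hγ : γ ≠ 1) : ∃ P : MvPolynomial (Fin 4) ℝ, P ≠ 0 ∧
      ∀ a ∈ coords '' S k γ, eval a P = 0 := by
  obtain ⟨A, rfl⟩ := QuotientGroup.mk_surjective γ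
  suffices h : ∃ P : MvPolynomial (Fin 4) ℝ, P ≠ 0 ∧
      ∀ Z, Z ∈ F k → slAction k A Z ∈ F k → eval (coords Z) P = 0 by
    obtain ⟨P, hP, hP'⟩ := h
    refine ⟨P, hP, ?_⟩
    rintro _ ⟨Z, hZ, rfl⟩
    rw [mem_S_mk] at hZ
    exact hP' Z hZ.1 hZ.2
  by_cases hc : A 1 0 = 0
  swap
  · obtain ⟨P, hP, hP'⟩ := exists_polynomial_normCD hk hk1 (A 1 1) hc
    exact ⟨P, hP, fun Z hZ hAZ => hP' Z (normCD_eq_one A hZ.2 hAZ.2)⟩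
  obtain ⟨hε1, -, hεmin⟩ := exists_unit_val_eq_ε₀ hk hk1
  have hdet := A.det_coe
  rw [Matrix.det_fin_two, hc, mul_zero, sub_zero] at hdet
  have hval : val k (A 0 0) * val k (A 1 1) = 1 := by rw [← map_mul, hdet, map_one]
  have hr := ratio_slAction_of_eq_zero hk hk1 A hc
  -- a unit of absolute value greater than `1` has absolute value at least `ε₀`
  have hgap : ∀ {α β : R k}, α * β = 1 → 1 < |val k α| → ε₀ k ^ 4 ≤ val k α ^ 4 := by
    intro α β hαβ h1
    have h2 : ε₀ k ≤ |val k α| := by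
      rcases abs_cases (val k α) with ⟨h, -⟩ | ⟨h, -⟩
      · rw [h] at h1 ⊢
        exact hεmin ⟨α, β, hαβ, by rw [mul_comm, hαβ]⟩ h1
      · rw [h] at h1 ⊢
        have := hεmin ⟨-α, -β, by rw [neg_mul_neg, hαβ], by rw [neg_mul_neg, mul_comm, hαβ]⟩
          (by simpa using h1)
        simpa using this
    calc ε₀ k ^ 4 ≤ |val k α| ^ 4 := by gcongr
      _ = val k α ^ 4 := by rw [← abs_pow]; exact abs_of_nonneg (by positivity)
  have hε2 : ε₀ k ^ 4 * (ε₀ k ^ 2)⁻¹ = ε₀ k ^ 2 := by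
    have : ε₀ k ≠ 0 := by linarith
    field_simp
  have hε3 : (ε₀ k ^ 2)⁻¹ * ε₀ k ^ 2 = 1 := by
    have : ε₀ k ≠ 0 := by linarith
    field_simp
  have hε4 : 0 < (ε₀ k ^ 2)⁻¹ := by positivity
  rcases lt_trichotomy |val k (A 1 1)| 1 with h | h | h
  · obtain ⟨P, hP, hP'⟩ := exists_polynomial_ratio k
    refine ⟨P, hP, fun Z hZ hAZ => hP' Z (Or.inr ?_)⟩
    have h1 : 1 < |val k (A 0 0)| := by
      have : |val k (A 0 0)| * |val k (A 1 1)| = 1 := by rw [← abs_mul, hval, abs_one]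
      by_contra! hcon
      nlinarith [abs_nonneg (val k (A 0 0)), abs_nonneg (val k (A 1 1))]
    have h2 := hgap hdet h1
    have h3 : ratio (slAction k A Z) = ratio Z * val k (A 0 0) ^ 4 := by
      have h4 : (val k (A 1 1)) ^ 4 * val k (A 0 0) ^ 4 = 1 := by
        rw [← mul_pow, mul_comm, hval, one_pow]
      rw [← hr Z, mul_assoc, h4, mul_one]
    have h5 := hAZ.1.2.2.2
    have h6 := hZ.1.2.2.1
    rw [h3] at h5
    have h7 : ratio Z * ε₀ k ^ 4 ≤ ε₀ k ^ 2 :=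
      (mul_le_mul_of_nonneg_left h2 (hε4.le.trans h6)).trans h5
    have h8 : (ratio Z - (ε₀ k ^ 2)⁻¹) * ε₀ k ^ 4 ≤ 0 := by nlinarith
    have h9 : (0 : ℝ) < ε₀ k ^ 4 := by positivity
    nlinarith
  · -- the diagonal entries are `1` or `-1`, so `A` acts as a translation
    have hdd : A 1 1 * A 1 1 = 1 := by
      apply val_injective hk hk1
      rw [map_mul, map_one, ← abs_mul_abs_self, h, one_mul]
    have had : A 0 0 = A 1 1 := by
      calc A 0 0 = A 0 0 * (A 1 1 * A 1 1) := by rw [hdd, mul_one]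
        _ = A 1 1 := by rw [← mul_assoc, hdet, one_mul]
    have hb : A 0 1 ≠ 0 := by
      intro hb
      apply hγ
      rw [QuotientGroup.eq_one_iff, Matrix.SpecialLinearGroup.mem_center_iff]
      refine ⟨A 1 1, by simpa [sq] using hdd, ?_⟩
      refine Matrix.ext fun i j => ?_
      fin_cases i <;> fin_cases j <;> simp [hb, hc, had]
    set β : R k := A 0 1 * A 1 1 with hβ
    have hβ0 : β ≠ 0 := by
      intro h0
      apply hb
      calc A 0 1 = β * A 1 1 := by rw [hβ, mul_assoc, hdd, mul_one]
        _ = 0 := by rw [h0, zero_mul]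
    have hre1 (Z : ℍ × ℍ) : (slAction k A Z).1.re = Z.1.re + val k β := by
      have h1 : val k (A 1 1) * val k (A 1 1) = 1 := by rw [← map_mul, hdd, map_one]
      rw [re_fst_slAction, hc, map_zero, absSq_zero, pow_two (val k (A 1 1)), h1, had, hβ, map_mul]
      linear_combination Z.1.re * h1
    have hre2 (Z : ℍ × ℍ) : (slAction k A Z).2.re = Z.2.re + conj k β := by
      have h1 : conj k (A 1 1) * conj k (A 1 1) = 1 := by rw [← map_mul, hdd, map_one]
      rw [re_snd_slAction, hc, map_zero, absSq_zero, pow_two (conj k (A 1 1)), h1, had, hβ, map_mul]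
      linear_combination Z.2.re * h1
    by_cases hβre : β.re = 0
    · have hβim : β.im ≠ 0 := fun h => hβ0 (QuadraticAlgebra.ext hβre h)
      obtain ⟨P, hP, hP'⟩ := exists_polynomial_s₂ k
      refine ⟨P, hP, fun Z hZ hAZ => hP' Z ?_⟩
      have h1 := hAZ.1.2.1
      rw [s₂_add hk1 β (hre1 Z) (hre2 Z)] at h1
      exact sq_eq_of_abs_le_of_abs_add_le hβim hZ.1.2.1 h1
    · obtain ⟨P, hP, hP'⟩ := exists_polynomial_s₁ k
      refine ⟨P, hP, fun Z hZ hAZ => hP' Z ?_⟩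
      have h1 := hAZ.1.1
      rw [s₁_add hk1 β (hre1 Z) (hre2 Z)] at h1
      exact sq_eq_of_abs_le_of_abs_add_le hβre hZ.1.1 h1
  · obtain ⟨P, hP, hP'⟩ := exists_polynomial_ratio k
    refine ⟨P, hP, fun Z hZ hAZ => hP' Z (Or.inl ?_)⟩
    have h2 := hgap (by rw [mul_comm]; exact hdet) h
    have h5 := hAZ.1.2.2.1
    have h6 := hZ.1.2.2.2
    have h7 : (ε₀ k ^ 2)⁻¹ * ε₀ k ^ 4 ≤ ratio Z := by
      rw [← hr Z]
      exact mul_le_mul h5 h2 (by positivity) (hε4.le.trans h5)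
    nlinarith

/-! ### Finiteness of the set of translates meeting a compact box -/

theorem re_fst_eq {k : ℕ} (hk1 : 1 < k) (Z : ℍ × ℍ) : Z.1.re = s₁ k Z + s₂ k Z * ω k := by
  have h := ω_sub_ω'_pos hk1
  have h1 : ω k - ω' k ≠ 0 := h.ne'
  have h2 : ω' k - ω k ≠ 0 := by linarith
  rw [s₁, s₂, ← neg_sub (ω k) (ω' k)]
  field_simp
  ring

theorem re_snd_eq {k : ℕ} (hk1 : 1 < k) (Z : ℍ × ℍ) : Z.2.re = s₁ k Z + s₂ k Z * ω' k := by
  have h := ω_sub_ω'_pos hk1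
  have h1 : ω k - ω' k ≠ 0 := h.ne'
  have h2 : ω' k - ω k ≠ 0 := by linarith
  rw [s₁, s₂, ← neg_sub (ω k) (ω' k)]
  field_simp
  ring

theorem normCD_of_eq_zero {k : ℕ} (hk : Squarefree k) (hk1 : 1 < k) (A : SL(2, R k))
    (hc : A 1 0 = 0) (Z : ℍ × ℍ) : normCD k (A 1 0) (A 1 1) Z = 1 := by
  have hdet := A.det_coe
  rw [Matrix.det_fin_two, hc, mul_zero, sub_zero, mul_comm] at hdet
  have h1 := abs_val_mul_abs_conj_of_mul_eq_one hk hk1 hdet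
  rw [normCD_eq, hc, map_zero, map_zero, absSq_zero, absSq_zero, ← sq_abs (val _ _),
    ← sq_abs (conj _ _), ← mul_pow, h1, one_pow]

theorem height_slAction_of_eq_zero {k : ℕ} (hk : Squarefree k) (hk1 : 1 < k) (A : SL(2, R k))
    (hc : A 1 0 = 0) (Z : ℍ × ℍ) : height (slAction k A Z) = height Z := by
  rw [height_slAction, normCD_of_eq_zero hk hk1 A hc, div_one]

theorem sq_height_le_normCD {k : ℕ} (hk : Squarefree k) (hk1 : 1 < k) {c : R k} (d : R k)
    (hc : c ≠ 0) (Z : ℍ × ℍ) : height Z ^ 2 ≤ normCD k c d Z := by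
  calc height Z ^ 2 ≤ (val k c ^ 2 * conj k c ^ 2) * height Z ^ 2 :=
        le_mul_of_one_le_left (sq_nonneg _) (one_le_sq_val_mul_sq_conj hk hk1 hc)
    _ = (val k c ^ 2 * Z.1.im ^ 2) * (conj k c ^ 2 * Z.2.im ^ 2) := by
        rw [height]; ring
    _ ≤ _ := by
        rw [normCD_eq]
        exact mul_le_mul (sq_mul_sq_im_le_absSq _ _ _) (sq_mul_sq_im_le_absSq _ _ _)
          (by positivity) (absSq_nonneg _ _ _)

theorem height_slAction_le_of_ne_zero {k : ℕ} (hk : Squarefree k) (hk1 : 1 < k) (A : SL(2, R k))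
    (hc : A 1 0 ≠ 0) (Z : ℍ × ℍ) : height (slAction k A Z) ≤ (height Z)⁻¹ := by
  have h0 := height_pos Z
  rw [height_slAction, div_le_iff₀ (normCD_pos A Z)]
  calc height Z = (height Z)⁻¹ * height Z ^ 2 := by field_simp
    _ ≤ _ := by
      gcongr
      exact sq_height_le_normCD hk hk1 _ hc Z

/-- The elements of `SL(2, ℝ)` moving some point of one compact box of the upper half plane into
another have bounded entries. -/
theorem exists_bound_entries {M m X l L : ℝ} (hM : 0 ≤ M) (hm : 0 < m) (hX : 0 ≤ X) (hl : 0 < l)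
    (hL : 0 ≤ L) :
    ∃ C : ℝ, ∀ (g : SL(2, ℝ)) (z : ℍ), |z.re| ≤ M → m ≤ z.im → z.im ≤ M →
      |(g • z).re| ≤ X → l ≤ (g • z).im → (g • z).im ≤ L → ∀ i j, |g i j| ≤ C := by
  have aux : ∀ {c d T J m : ℝ} {z : ℍ}, 0 ≤ J → 0 < m → |z.re| ≤ T → m ≤ z.im →
      absSq c d z ≤ J → |c| ≤ √J / m ∧ |c * z.re + d| ≤ √J ∧ |d| ≤ √J + √J / m * T := by
    intro c d T J m z hJ hm hT hmz h
    have h1 : |c * z.re + d| ≤ √J := by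
      apply Real.abs_le_sqrt
      unfold absSq at h
      nlinarith [sq_nonneg (c * z.im)]
    have h2 : |c * m| ≤ √J := by
      apply Real.abs_le_sqrt
      have h3 := (sq_mul_sq_im_le_absSq c d z).trans h
      refine le_trans ?_ h3
      rw [mul_pow]
      gcongr
    have h3 : |c| ≤ √J / m := by
      rw [le_div_iff₀ hm, ← abs_of_pos hm, ← abs_mul]
      exact h2
    refine ⟨h3, h1, ?_⟩
    calc |d| = |(c * z.re + d) - c * z.re| := by ring_nf
      _ ≤ |c * z.re + d| + |c * z.re| := abs_sub _ _
      _ ≤ √J + √J / m * T := by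
          rw [abs_mul]
          exact add_le_add h1 (mul_le_mul h3 hT (abs_nonneg _) (by positivity))
  set J := M / l
  set J' := L / m
  set Cc := √J / m
  set Cd := √J + √J / m * M
  set Ca := √J' + √J' / l * X
  have hJ : 0 ≤ J := by positivity
  have hJ' : 0 ≤ J' := by positivity
  refine ⟨max (max Ca (Cc * M * L + X * √J + Ca * M)) (max Cc Cd), ?_⟩
  intro g z hx hmz hzM hX' hl' hL'
  have hz := z.im_pos
  have hw := (g • z).im_pos
  have hj := im_smul_eq g z
  have hjpos := absSq_pos g z
  have h1 : absSq (g 1 0) (g 1 1) z ≤ J := by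
    have : absSq (g 1 0) (g 1 1) z = z.im / (g • z).im := by
      rw [hj]; field_simp
    rw [this]
    exact div_le_div₀ hM hzM hl hl'
  obtain ⟨hc, hcd, hd⟩ := aux hJ hm hx hmz h1
  -- the bottom row of `g⁻¹` bounds `a`
  have h2 : absSq (-g 1 0) (g 0 0) (g • z) ≤ J' := by
    have h3 := im_smul_eq g⁻¹ (g • z)
    rw [inv_smul_smul] at h3
    have e1 : (g⁻¹ : SL(2, ℝ)) 1 0 = -g 1 0 := by
      rw [Matrix.SpecialLinearGroup.SL2_inv_expl]; simp
    have e2 : (g⁻¹ : SL(2, ℝ)) 1 1 = g 0 0 := by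
      rw [Matrix.SpecialLinearGroup.SL2_inv_expl]; simp
    have h4 := absSq_pos g⁻¹ (g • z)
    rw [e1, e2] at h3 h4
    have : absSq (-g 1 0) (g 0 0) (g • z) = (g • z).im / z.im := by
      rw [eq_div_iff hz.ne', mul_comm, ← eq_div_iff h4.ne']
      exact h3
    rw [this]
    exact div_le_div₀ hL hL' hm hmz
  obtain ⟨-, -, ha⟩ := aux hJ' hl hX' hl' h2
  -- `b` is the real part of `(g • z) (c z + d) - a z`
  have hb : |g 0 1| ≤ Cc * M * L + X * √J + Ca * M := by
    have h5 : g 0 1 = (g • z).re * (g 1 0 * z.re + g 1 1) - (g • z).im * (g 1 0 * z.im) -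
        g 0 0 * z.re := by
      have hden : ((g 1 0 : ℂ) * z + g 1 1) ≠ 0 := by
        intro h
        have := normSq_eq_absSq (g 1 0) (g 1 1) z
        rw [h, map_zero] at this
        exact hjpos.ne this
      have h6 := congrArg Complex.re ((eq_div_iff hden).1 (coe_smul_eq g z))
      simp only [Complex.add_im, Complex.add_re, Complex.mul_im, Complex.mul_re, Complex.ofReal_re,
        Complex.ofReal_im, UpperHalfPlane.coe_re, UpperHalfPlane.coe_im] at h6
      linear_combination -h6
    have t1 : |(g • z).re * (g 1 0 * z.re + g 1 1)| ≤ X * √J := by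
      rw [abs_mul]; exact mul_le_mul hX' hcd (abs_nonneg _) hX
    have t2 : |(g • z).im * (g 1 0 * z.im)| ≤ Cc * M * L := by
      rw [abs_mul, abs_mul, abs_of_pos hw, abs_of_pos hz, mul_comm]
      exact mul_le_mul (mul_le_mul hc hzM hz.le (by positivity)) hL' hw.le (by positivity)
    have t3 : |g 0 0 * z.re| ≤ Ca * M := by
      rw [abs_mul]; exact mul_le_mul ha hx (abs_nonneg _) (by positivity)
    rw [h5]
    refine (abs_sub _ _).trans ?_
    refine add_le_add ((abs_sub _ _).trans ?_) t3
    linarith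
  intro i j
  fin_cases i <;> fin_cases j
  · exact ha.trans ((le_max_left _ _).trans (le_max_left _ _))
  · exact hb.trans ((le_max_right _ _).trans (le_max_left _ _))
  · exact hc.trans ((le_max_left _ _).trans (le_max_right _ _))
  · exact hd.trans ((le_max_right _ _).trans (le_max_right _ _))

/-- The compact box `|x₁|, |x₂| ≤ M`, `m ≤ y₁, y₂ ≤ M` in `ℍ × ℍ`. -/
def box (m M : ℝ) : Set (ℍ × ℍ) :=
  {Z | (|Z.1.re| ≤ M ∧ m ≤ Z.1.im ∧ Z.1.im ≤ M) ∧ |Z.2.re| ≤ M ∧ m ≤ Z.2.im ∧ Z.2.im ≤ M}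

/-- Only finitely many elements of `SL₂(R)` move a point of a given compact box into `𝓕_∞` without
decreasing its height.  The height of the image is bounded above and below, hence so are both of its
imaginary parts, as their ratio is bounded in `𝓕_∞`; so all matrix entries are bounded in both
real embeddings. -/
theorem finite_setOf_slAction_mem_FInfty {k : ℕ} (hk : Squarefree k) (hk1 : 1 < k) {m M : ℝ}
    (hm : 0 < m) : {B : SL(2, R k) | ∃ Z ∈ box m M, slAction k B Z ∈ FInfty k ∧
      height Z ≤ height (slAction k B Z)}.Finite := by
  by_cases hM : 0 ≤ M
  swap
  · convert Set.finite_empty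
    ext B
    simp only [Set.mem_ofPred_eq, Set.mem_empty_iff_false, iff_false]
    rintro ⟨Z, ⟨⟨h, -⟩, -⟩, -⟩
    exact hM ((abs_nonneg _).trans h)
  obtain ⟨hε1, -, -⟩ := exists_unit_val_eq_ε₀ hk hk1
  have hε0 : 0 < ε₀ k := by linarith
  set e := ε₀ k ^ 2
  have he : 0 < e := by positivity
  set X := 1 + |ω k| + |ω' k|
  have hX : 0 ≤ X := by positivity
  set H := M ^ 2 + (m ^ 2)⁻¹
  have hH : 0 ≤ H := by positivity
  set l := m / ε₀ k
  have hl : 0 < l := by positivity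
  set L := H * e + 1
  have hL : 0 ≤ L := by positivity
  obtain ⟨C, hC⟩ := exists_bound_entries hM hm hX hl hL
  suffices h : ∀ B : SL(2, R k), (∃ Z ∈ box m M, slAction k B Z ∈ FInfty k ∧
      height Z ≤ height (slAction k B Z)) →
      ∀ i j, B i j ∈ {α : R k | |val k α| ≤ C ∧ |conj k α| ≤ C} by
    have hT := finite_setOf_abs_le hk1 C
    have h2 := Set.Finite.pi' (ι := Fin 2) fun _ => Set.Finite.pi' (ι := Fin 2) fun _ => hT
    exact (h2.preimage (Subtype.val_injective.injOn)).subset fun B hB => h B hB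
  rintro B ⟨Z, ⟨⟨hx1, hm1, hM1⟩, hx2, hm2, hM2⟩, hW, hh⟩ i j
  have hy1 := (slAction k B Z).1.im_pos
  have hy2 := (slAction k B Z).2.im_pos
  obtain ⟨hs1, hs2, hr1, hr2⟩ := hW
  have hZ : m ^ 2 ≤ height Z := by
    rw [height, sq]; exact mul_le_mul hm1 hm2 hm.le (hm.le.trans hm1)
  have hWH : height (slAction k B Z) ≤ H := by
    by_cases hc : B 1 0 = 0
    · rw [height_slAction_of_eq_zero hk hk1 B hc]
      have : height Z ≤ M ^ 2 := by
        rw [height, sq]; exact mul_le_mul hM1 hM2 Z.2.im_pos.le hM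
      have : 0 ≤ (m ^ 2)⁻¹ := by positivity
      linarith
    · refine (height_slAction_le_of_ne_zero hk hk1 B hc Z).trans ?_
      have : (height Z)⁻¹ ≤ (m ^ 2)⁻¹ := by gcongr
      have : 0 ≤ M ^ 2 := by positivity
      linarith
  have hWm := hZ.trans hh
  rw [ratio, div_le_iff₀ hy2] at hr2
  rw [ratio, le_div_iff₀ hy2, inv_mul_le_iff₀ he] at hr1
  have hx1' : |(slAction k B Z).1.re| ≤ X := by
    rw [re_fst_eq hk1]
    refine (abs_add_le _ _).trans ?_
    rw [abs_mul]
    have : |s₂ k (slAction k B Z)| * |ω k| ≤ 1 * |ω k| := by gcongr; linarith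
    have := abs_nonneg (ω' k)
    linarith
  have hx2' : |(slAction k B Z).2.re| ≤ X := by
    rw [re_snd_eq hk1]
    refine (abs_add_le _ _).trans ?_
    rw [abs_mul]
    have : |s₂ k (slAction k B Z)| * |ω' k| ≤ 1 * |ω' k| := by gcongr; linarith
    have := abs_nonneg (ω k)
    linarith
  rw [height] at hWm hWH
  clear_value H
  -- of the two imaginary parts, each is at most `ε₀²` times the other
  have key : ∀ {u v : ℝ}, 0 < u → 0 < v → m ^ 2 ≤ u * v → u * v ≤ H → u ≤ e * v → v ≤ e * u →
      l ≤ u ∧ u ≤ L := by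
    intro u v hu hv h1 h2 h3 h4
    constructor
    · have h5 : m ^ 2 ≤ (ε₀ k * u) ^ 2 := by
        calc m ^ 2 ≤ u * v := h1
          _ ≤ u * (e * u) := by gcongr
          _ = (ε₀ k * u) ^ 2 := by ring
      rw [div_le_iff₀ hε0, mul_comm]
      exact (sq_le_sq₀ hm.le (by positivity)).1 h5
    · have h5 : u * u ≤ H * e := by nlinarith
      change u ≤ H * e + 1
      nlinarith
  obtain ⟨hl1, hL1⟩ := key hy1 hy2 hWm hWH hr2 hr1
  obtain ⟨hl2, hL2⟩ := key hy2 hy1 (by rwa [mul_comm]) (by rwa [mul_comm]) hr1 hr2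
  exact ⟨hC _ Z.1 hx1 hm1 hM1 hx1' hl1 hL1 i j, hC _ Z.2 hx2 hm2 hM2 hx2' hl2 hL2 i j⟩

/-! ### The translates of `𝓕` cover `ℍ × ℍ` -/

/-- The stabilizer of `∞` moves every point into `𝓕_∞`: a power of the fundamental unit adjusts the
ratio `y₁ / y₂`, and a translation adjusts `s₁` and `s₂`. -/
theorem exists_slAction_mem_FInfty {k : ℕ} (hk : Squarefree k) (hk1 : 1 < k) (Z : ℍ × ℍ) :
    ∃ B : SL(2, R k), slAction k B Z ∈ FInfty k ∧ height (slAction k B Z) = height Z := by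
  obtain ⟨hε1, ⟨u, hu⟩, -⟩ := exists_unit_val_eq_ε₀ hk hk1
  have hε0 : ε₀ k ≠ 0 := by linarith
  have hrat : 0 < ratio Z := div_pos Z.1.im_pos Z.2.im_pos
  obtain ⟨n, hn1, hn2⟩ := exists_mem_Ioc_zpow (x := ratio Z * ε₀ k ^ 2) (y := ε₀ k ^ 4)
    (by positivity) (one_lt_pow₀ hε1 (by norm_num))
  -- the diagonal matrix with entries `u⁻ⁿ, uⁿ` divides the ratio by `ε₀⁴ⁿ`
  let D : SL(2, R k) := ⟨!![((u ^ n)⁻¹ : (R k)ˣ), 0; 0, (u ^ n : (R k)ˣ)], by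
    rw [Matrix.det_fin_two_of, Units.inv_mul]; ring⟩
  have hD : D 1 0 = 0 := rfl
  have hD1 : val k (D 1 1) = ε₀ k ^ n := by
    change val k ((u ^ n : (R k)ˣ) : R k) = _
    rw [← hu]
    exact (congrArg Units.val (map_zpow (Units.map (val k : R k →* ℝ)) u n)).trans
      (Units.val_zpow_eq_zpow_val _ _)
  set W := slAction k D Z with hW
  let β : R k := ⟨-round (s₁ k W), -round (s₂ k W)⟩
  let T : SL(2, R k) := ⟨!![1, β; 0, 1], by rw [Matrix.det_fin_two_of]; ring⟩
  have hT : T 1 0 = 0 := rfl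
  have hT0 : T 0 0 = 1 := rfl
  have hT1 : T 1 1 = 1 := rfl
  have hTb : T 0 1 = β := rfl
  have hre1 : (slAction k T W).1.re = W.1.re + val k β := by
    rw [re_fst_slAction, hT, hT0, hT1, hTb]; simp [absSq_zero]
  have hre2 : (slAction k T W).2.re = W.2.re + conj k β := by
    rw [re_snd_slAction, hT, hT0, hT1, hTb]; simp [absSq_zero]
  have hr := ratio_slAction_of_eq_zero hk hk1 D hD Z
  have hrT := ratio_slAction_of_eq_zero hk hk1 T hT W
  rw [hT1, map_one, one_pow, mul_one] at hrT
  rw [← hW, hD1] at hr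
  have hpow : (ε₀ k ^ n) ^ 4 = (ε₀ k ^ 4) ^ n := by
    rw [← zpow_natCast, ← zpow_natCast, zpow_comm]
  rw [hpow] at hr
  have hp : 0 < (ε₀ k ^ 4) ^ n := by positivity
  refine ⟨T * D, ?_, ?_⟩
  · rw [map_mul, Equiv.Perm.mul_apply, ← hW]
    refine ⟨?_, ?_, ?_, ?_⟩
    · rw [s₁_add hk1 β hre1 hre2]
      simpa [β, ← sub_eq_add_neg] using abs_sub_round (s₁ k W)
    · rw [s₂_add hk1 β hre1 hre2]
      simpa [β, ← sub_eq_add_neg] using abs_sub_round (s₂ k W)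
    · rw [hrT, inv_le_iff_one_le_mul₀ (by positivity)]
      rw [← hr] at hn1
      nlinarith
    · rw [hrT]
      rw [← hr, zpow_add_one₀ (by positivity)] at hn2
      have h1 : ratio W * ε₀ k ^ 2 ≤ ε₀ k ^ 2 * ε₀ k ^ 2 := by
        have : (ε₀ k ^ 4) ^ n * (ratio W * ε₀ k ^ 2) ≤
            (ε₀ k ^ 4) ^ n * (ε₀ k ^ 2 * ε₀ k ^ 2) := by
          calc _ = ratio W * (ε₀ k ^ 4) ^ n * ε₀ k ^ 2 := by ring
            _ ≤ _ := hn2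
            _ = _ := by ring
        exact le_of_mul_le_mul_left this hp
      exact le_of_mul_le_mul_right h1 (by positivity)
  · rw [map_mul, Equiv.Perm.mul_apply, ← hW, height_slAction_of_eq_zero hk hk1 T hT, hW,
      height_slAction_of_eq_zero hk hk1 D hD]

theorem exists_mem_box (Z : ℍ × ℍ) : ∃ m M : ℝ, 0 < m ∧ Z ∈ box m M := by
  refine ⟨min Z.1.im Z.2.im, max (max |Z.1.re| |Z.2.re|) (max Z.1.im Z.2.im),
    lt_min Z.1.im_pos Z.2.im_pos, ?_⟩
  refine ⟨⟨?_, ?_, ?_⟩, ?_, ?_, ?_⟩ <;> simp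

/-- The translates of `𝓕` cover `ℍ × ℍ`: among the finitely many points of the orbit in `𝓕_∞` that
are not lower than the given one, a highest one lies in `𝓕`. -/
theorem exists_slAction_mem_F {k : ℕ} (hk : Squarefree k) (hk1 : 1 < k) (Z : ℍ × ℍ) :
    ∃ B : SL(2, R k), slAction k B Z ∈ F k := by
  obtain ⟨m, M, hm, hZ⟩ := exists_mem_box Z
  have hfin : {B : SL(2, R k) | slAction k B Z ∈ FInfty k ∧
      height Z ≤ height (slAction k B Z)}.Finite :=
    (finite_setOf_slAction_mem_FInfty hk hk1 hm).subset fun B hB => ⟨Z, hZ, hB⟩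
  obtain ⟨B₀, hB₀, hB₀'⟩ := exists_slAction_mem_FInfty hk hk1 Z
  obtain ⟨B, ⟨hB1, hB2⟩, hmax⟩ := Set.exists_max_image _ (fun B => height (slAction k B Z)) hfin
    ⟨B₀, hB₀, hB₀'.ge⟩
  refine ⟨B, hB1, fun c d hcd => ?_⟩
  by_contra! hlt
  obtain ⟨x, y', hy', hxy⟩ := Ideal.mem_span_singleton_sup.1
    ((Ideal.eq_top_iff_one _).1 hcd)
  obtain ⟨y, rfl⟩ := Ideal.mem_span_singleton.1 hy'
  let A : SL(2, R k) := ⟨!![y, -x; c, d], by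
    rw [Matrix.det_fin_two_of]; linear_combination hxy⟩
  generalize hW : slAction k B Z = W at *
  have h1 : height W < height (slAction k A W) := by
    rw [height_slAction, lt_div_iff₀ (normCD_pos A W)]
    exact mul_lt_of_lt_one_right (height_pos W) hlt
  obtain ⟨T, hT, hT'⟩ := exists_slAction_mem_FInfty hk hk1 (slAction k A W)
  have h2 : slAction k (T * A * B) Z = slAction k T (slAction k A W) := by
    rw [map_mul, map_mul, Equiv.Perm.mul_apply, Equiv.Perm.mul_apply, hW]
  have h3 := hmax (T * A * B) ⟨by rw [h2]; exact hT, by rw [h2, hT']; linarith⟩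
  simp only [h2, hT'] at h3
  linarith

/-- Only finitely many translates of `𝓕` meet a given compact box. -/
theorem finite_setOf_slAction_mem_F {k : ℕ} (hk : Squarefree k) (hk1 : 1 < k) {m M : ℝ}
    (hm : 0 < m) : {B : SL(2, R k) | ∃ Z ∈ box m M, slAction k B Z ∈ F k}.Finite := by
  refine (finite_setOf_slAction_mem_FInfty (M := M) hk hk1 hm).subset ?_
  rintro B ⟨Z, hZ, hB⟩
  refine ⟨Z, hZ, hB.1, ?_⟩
  have h := height_slAction_le B⁻¹ hB.2
  rwa [← Equiv.Perm.mul_apply, ← map_mul, inv_mul_cancel, map_one, Equiv.Perm.one_apply] at h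

/-! ### Topology of `𝓕` -/

theorem continuous_slAction {k : ℕ} (A : SL(2, R k)) : Continuous (slAction k A) := by
  change Continuous fun Z : ℍ × ℍ => (Matrix.SpecialLinearGroup.map (val k) A • Z.1,
    Matrix.SpecialLinearGroup.map (conj k) A • Z.2)
  exact (continuous_fst.const_smul _).prodMk (continuous_snd.const_smul _)

theorem continuous_s₁ (k : ℕ) : Continuous (s₁ k) := by
  have := UpperHalfPlane.continuous_re
  unfold s₁
  fun_prop

theorem continuous_s₂ (k : ℕ) : Continuous (s₂ k) := by
  have := UpperHalfPlane.continuous_re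
  unfold s₂
  fun_prop

theorem continuous_ratio : Continuous ratio := by
  have := UpperHalfPlane.continuous_im
  unfold ratio
  exact Continuous.div (by fun_prop) (by fun_prop) fun Z => Z.2.im_pos.ne'

theorem isClosed_F (k : ℕ) : IsClosed (F k) := by
  have h1 := UpperHalfPlane.continuous_re
  have h2 := UpperHalfPlane.continuous_im
  refine IsClosed.inter ?_ ?_
  · refine (isClosed_le (continuous_s₁ k).abs continuous_const).inter
      ((isClosed_le (continuous_s₂ k).abs continuous_const).inter
        ((isClosed_le continuous_const continuous_ratio).inter
          (isClosed_le continuous_ratio continuous_const)))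
  · have : FZero k = ⋂ (c : R k) (d : R k) (_ : Ideal.span {c} ⊔ Ideal.span {d} = ⊤),
        {Z | 1 ≤ normCD k c d Z} := by
      ext Z; simp [FZero]
    rw [this]
    refine isClosed_iInter fun c => isClosed_iInter fun d => isClosed_iInter fun _ => ?_
    refine isClosed_le continuous_const ?_
    unfold normCD
    fun_prop

/-- A nonempty open set contained in `𝓕`. -/
def openF (k : ℕ) : Set (ℍ × ℍ) :=
  {Z | |s₁ k Z| < 1 / 2 ∧ |s₂ k Z| < 1 / 2 ∧ (ε₀ k ^ 2)⁻¹ < ratio Z ∧ ratio Z < ε₀ k ^ 2 ∧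
    1 < height Z}

theorem isOpen_openF (k : ℕ) : IsOpen (openF k) := by
  have h2 := UpperHalfPlane.continuous_im
  have h3 : Continuous height := by
    unfold height
    fun_prop
  exact (isOpen_lt (continuous_s₁ k).abs continuous_const).inter
    ((isOpen_lt (continuous_s₂ k).abs continuous_const).inter
      ((isOpen_lt continuous_const continuous_ratio).inter
        ((isOpen_lt continuous_ratio continuous_const).inter
          (isOpen_lt continuous_const h3))))

theorem openF_subset_F {k : ℕ} (hk : Squarefree k) (hk1 : 1 < k) : openF k ⊆ F k := by
  rintro Z ⟨h1, h2, h3, h4, h5⟩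
  refine ⟨⟨h1.le, h2.le, h3.le, h4.le⟩, fun c d hcd => ?_⟩
  by_cases hc : c = 0
  · have hd : d ≠ 0 := by
      rintro rfl
      rw [hc] at hcd
      simp at hcd
    rw [normCD_eq, hc, map_zero, map_zero, absSq_zero, absSq_zero]
    exact one_le_sq_val_mul_sq_conj hk hk1 hd
  · exact (one_le_pow₀ h5.le).trans (sq_height_le_normCD hk hk1 d hc Z)

theorem exists_mem_openF {k : ℕ} (hk : Squarefree k) (hk1 : 1 < k) {x : ℝ} (hx : |x| < 1 / 2) :
    ∃ Z ∈ openF k, Z.1.re = x := by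
  obtain ⟨hε1, -, -⟩ := exists_unit_val_eq_ε₀ hk hk1
  let z : ℍ := ⟨⟨x, 2⟩, by norm_num⟩
  have hre : z.re = x := rfl
  have him : z.im = 2 := rfl
  have h1 : ω' k - ω k ≠ 0 := by have := ω_sub_ω'_pos hk1; linarith
  have h2 : 1 < ε₀ k ^ 2 := one_lt_pow₀ hε1 (by norm_num)
  refine ⟨(z, z), ⟨?_, ?_, ?_, ?_, ?_⟩, rfl⟩
  · rw [s₁, ← sub_mul, mul_div_cancel_left₀ _ h1]
    exact hx
  · simp [s₂]
  · rw [ratio, div_self z.im_pos.ne']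
    exact inv_lt_one_of_one_lt₀ h2
  · rw [ratio, div_self z.im_pos.ne']
    exact h2
  · rw [height, him]; norm_num

/-! ### Segments in `ℍ × ℍ` -/

/-- The point of `ℍ × ℍ` with coordinates `a = (x₁, x₂, y₁, y₂)`, a junk value unless
`y₁` and `y₂` are positive. -/
noncomputable def ofCoords (a : Fin 4 → ℝ) : ℍ × ℍ :=
  (UpperHalfPlane.ofComplex (a 0 + a 2 * Complex.I),
    UpperHalfPlane.ofComplex (a 1 + a 3 * Complex.I))

theorem ofCoords_coords (Z : ℍ × ℍ) : ofCoords (coords Z) = Z := by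
  have h (z : ℍ) : UpperHalfPlane.ofComplex (z.re + z.im * Complex.I) = z := by
    have : ((z.re : ℂ) + z.im * Complex.I) = (z : ℂ) := by
      apply Complex.ext <;> simp
    rw [this, UpperHalfPlane.ofComplex_apply]
  exact Prod.ext (h Z.1) (h Z.2)

theorem coords_ofCoords {a : Fin 4 → ℝ} (h2 : 0 < a 2) (h3 : 0 < a 3) :
    coords (ofCoords a) = a := by
  have h {x y : ℝ} (hy : 0 < y) :
      (UpperHalfPlane.ofComplex (x + y * Complex.I)).re = x ∧
        (UpperHalfPlane.ofComplex (x + y * Complex.I)).im = y := by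
    rw [UpperHalfPlane.ofComplex_apply_of_im_pos (by simpa using hy)]
    simp [← UpperHalfPlane.coe_re, ← UpperHalfPlane.coe_im]
  ext i
  fin_cases i
  · exact (h h2).1
  · exact (h h3).1
  · exact (h h2).2
  · exact (h h3).2

theorem continuousAt_ofCoords {a : Fin 4 → ℝ} (h2 : 0 < a 2) (h3 : 0 < a 3) :
    ContinuousAt ofCoords a := by
  have h {z : ℂ} (hz : 0 < z.im) : ContinuousAt UpperHalfPlane.ofComplex z := by
    obtain ⟨w, rfl⟩ : ∃ w : ℍ, (w : ℂ) = z := ⟨⟨z, hz⟩, rfl⟩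
    exact (UpperHalfPlane.contMDiffAt_ofComplex (n := 0) w.im_pos).continuousAt
  refine ContinuousAt.prodMk ?_ ?_
  · refine ContinuousAt.comp (f := fun a : Fin 4 → ℝ => (a 0 + a 2 * Complex.I : ℂ))
      (h (by simpa using h2)) ?_
    fun_prop
  · refine ContinuousAt.comp (f := fun a : Fin 4 → ℝ => (a 1 + a 3 * Complex.I : ℂ))
      (h (by simpa using h3)) ?_
    fun_prop

/-- The parametrization `t ↦ P + t (Q - P) + (0, w)` of a line parallel to that through `P` and `Q`,
shifted by `w` in the last three coordinates. -/
def linePt (P Q : Fin 4 → ℝ) (w : Fin 3 → ℝ) (t : ℝ) : Fin 4 → ℝ :=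
  fun i => P i + t * (Q i - P i) + (Fin.cons 0 w : Fin 4 → ℝ) i

theorem continuous_linePt (P Q : Fin 4 → ℝ) (w : Fin 3 → ℝ) : Continuous (linePt P Q w) := by
  unfold linePt
  fun_prop

theorem continuous_linePt_left (P Q : Fin 4 → ℝ) (t : ℝ) :
    Continuous fun w => linePt P Q w t := by
  refine continuous_pi fun i => continuous_const.add ?_
  refine Fin.cases ?_ (fun j => ?_) i
  · simpa using continuous_const
  · simpa using continuous_apply j

theorem eventually_ofCoords_mem {O : Set (ℍ × ℍ)} (hO : IsOpen O) {P : ℍ × ℍ} (hP : P ∈ O) :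
    ∀ᶠ a in nhds (coords P), ofCoords a ∈ O ∧ 0 < a 2 ∧ 0 < a 3 := by
  have h2 : 0 < coords P 2 := P.1.im_pos
  have h3 : 0 < coords P 3 := P.2.im_pos
  refine ((continuousAt_ofCoords h2 h3).eventually ?_).and
    ((continuous_apply 2).continuousAt.eventually (lt_mem_nhds h2) |>.and
      ((continuous_apply 3).continuousAt.eventually (lt_mem_nhds h3)))
  rw [ofCoords_coords]
  exact hO.mem_nhds hP

theorem ofCoords_mem_box_of_between {m M t : ℝ} {a b c : Fin 4 → ℝ} (hm : 0 < m)
    (ha2 : 0 < a 2) (ha3 : 0 < a 3) (hb2 : 0 < b 2) (hb3 : 0 < b 3)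
    (ha : ofCoords a ∈ box m M) (hb : ofCoords b ∈ box m M) (ht0 : 0 ≤ t) (ht1 : t ≤ 1)
    (hc : ∀ i, c i = (1 - t) * a i + t * b i) :
    0 < c 2 ∧ 0 < c 3 ∧ ofCoords c ∈ box m M := by
  have hbox : ∀ {e : Fin 4 → ℝ}, 0 < e 2 → 0 < e 3 → (ofCoords e ∈ box m M ↔
      (|e 0| ≤ M ∧ m ≤ e 2 ∧ e 2 ≤ M) ∧ |e 1| ≤ M ∧ m ≤ e 3 ∧ e 3 ≤ M) := by
    intro e h2 h3
    have h := coords_ofCoords h2 h3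
    rw [← congrFun h 0, ← congrFun h 1, ← congrFun h 2, ← congrFun h 3]
    rfl
  rw [hbox ha2 ha3] at ha
  rw [hbox hb2 hb3] at hb
  obtain ⟨⟨ha0, ham2, haM2⟩, ha1, ham3, haM3⟩ := ha
  obtain ⟨⟨hb0, hbm2, hbM2⟩, hb1, hbm3, hbM3⟩ := hb
  rw [abs_le] at ha0 ha1 hb0 hb1
  have ht1' : 0 ≤ 1 - t := by linarith
  have hc2 : m ≤ c 2 := by rw [hc]; nlinarith
  have hc3 : m ≤ c 3 := by rw [hc]; nlinarith
  refine ⟨hm.trans_le hc2, hm.trans_le hc3, (hbox (hm.trans_le hc2) (hm.trans_le hc3)).2 ?_⟩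
  refine ⟨⟨abs_le.2 ⟨?_, ?_⟩, hc2, ?_⟩, abs_le.2 ⟨?_, ?_⟩, hc3, ?_⟩ <;> rw [hc] <;> nlinarith

theorem box_subset_box {m m' M M' : ℝ} (hm : m' ≤ m) (hM : M ≤ M') : box m M ⊆ box m' M' := by
  rintro Z ⟨⟨h1, h2, h3⟩, h4, h5, h6⟩
  exact ⟨⟨h1.trans hM, hm.trans h2, h3.trans hM⟩, h4.trans hM, hm.trans h5, h6.trans hM⟩

/-- The segment `t ↦ linePt P Q w t`, `0 ≤ t ≤ 1`, is preconnected in `ℍ × ℍ` and stays in a compact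
box, if its ends lie in `ℍ × ℍ`. -/
theorem isPreconnected_segment {P Q : Fin 4 → ℝ} {w : Fin 3 → ℝ}
    (h02 : 0 < linePt P Q w 0 2) (h03 : 0 < linePt P Q w 0 3)
    (h12 : 0 < linePt P Q w 1 2) (h13 : 0 < linePt P Q w 1 3) :
    IsPreconnected ((fun t => ofCoords (linePt P Q w t)) '' Set.Icc 0 1) ∧
      ∃ m M : ℝ, 0 < m ∧ ∀ t ∈ Set.Icc (0 : ℝ) 1,
        ofCoords (linePt P Q w t) ∈ box m M ∧
          coords (ofCoords (linePt P Q w t)) = linePt P Q w t := by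
  obtain ⟨m, M, hm, h0⟩ := exists_mem_box (ofCoords (linePt P Q w 0))
  obtain ⟨m', M', hm', h1⟩ := exists_mem_box (ofCoords (linePt P Q w 1))
  have key : ∀ t ∈ Set.Icc (0 : ℝ) 1, 0 < linePt P Q w t 2 ∧ 0 < linePt P Q w t 3 ∧
      ofCoords (linePt P Q w t) ∈ box (min m m') (max M M') := fun t ht =>
    ofCoords_mem_box_of_between (lt_min hm hm') h02 h03 h12 h13
      (box_subset_box (min_le_left _ _) (le_max_left _ _) h0)
      (box_subset_box (min_le_right _ _) (le_max_right _ _) h1) ht.1 ht.2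
      fun i => by simp only [linePt]; ring
  refine ⟨isPreconnected_Icc.image _ fun t ht => ?_, min m m', max M M', lt_min hm hm',
    fun t ht => ⟨(key t ht).2.2, coords_ofCoords (key t ht).1 (key t ht).2.1⟩⟩
  exact ((continuousAt_ofCoords (key t ht).1 (key t ht).2.1).comp
    (continuous_linePt P Q w).continuousAt).continuousWithinAt

/-! ### Generic segments avoid translates of sets of codimension two -/

/-- The coordinates of `A Z` are rational functions of those of `Z` with a common denominator. -/
theorem exists_coords_slAction_eq_div {k : ℕ} (A : SL(2, R k)) :
    ∃ (D : MvPolynomial (Fin 4) ℝ) (N : Fin 4 → MvPolynomial (Fin 4) ℝ),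
      ∀ Z, eval (coords Z) D ≠ 0 ∧
        ∀ i, coords (slAction k A Z) i = eval (coords Z) (N i) / eval (coords Z) D := by
  let D₁ : MvPolynomial (Fin 4) ℝ :=
    (C (val k (A 1 0)) * X 0 + C (val k (A 1 1))) ^ 2 + C (val k (A 1 0)) ^ 2 * X 2 ^ 2
  let D₂ : MvPolynomial (Fin 4) ℝ :=
    (C (conj k (A 1 0)) * X 1 + C (conj k (A 1 1))) ^ 2 + C (conj k (A 1 0)) ^ 2 * X 3 ^ 2
  let N₁ : MvPolynomial (Fin 4) ℝ :=
    (C (val k (A 0 0)) * X 0 + C (val k (A 0 1))) * (C (val k (A 1 0)) * X 0 + C (val k (A 1 1))) +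
      C (val k (A 0 0)) * C (val k (A 1 0)) * X 2 ^ 2
  let N₂ : MvPolynomial (Fin 4) ℝ :=
    (C (conj k (A 0 0)) * X 1 + C (conj k (A 0 1))) *
      (C (conj k (A 1 0)) * X 1 + C (conj k (A 1 1))) +
      C (conj k (A 0 0)) * C (conj k (A 1 0)) * X 3 ^ 2
  refine ⟨D₁ * D₂, ![N₁ * D₂, N₂ * D₁, X 2 * D₂, X 3 * D₁], fun Z => ?_⟩
  have e1 : eval (coords Z) D₁ = absSq (val k (A 1 0)) (val k (A 1 1)) Z.1 := by
    simp [D₁, coords, absSq]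
  have e2 : eval (coords Z) D₂ = absSq (conj k (A 1 0)) (conj k (A 1 1)) Z.2 := by
    simp [D₂, coords, absSq]
  have h1 : absSq (val k (A 1 0)) (val k (A 1 1)) Z.1 ≠ 0 :=
    (absSq_pos (Matrix.SpecialLinearGroup.map (val k) A) Z.1).ne'
  have h2 : absSq (conj k (A 1 0)) (conj k (A 1 1)) Z.2 ≠ 0 :=
    (absSq_pos (Matrix.SpecialLinearGroup.map (conj k) A) Z.2).ne'
  rw [map_mul, e1, e2]
  refine ⟨mul_ne_zero h1 h2, fun i => ?_⟩
  fin_cases i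
  · change (slAction k A Z).1.re = eval _ (N₁ * D₂) / _
    rw [re_fst_slAction, map_mul, e2, mul_div_mul_right _ _ h2]
    simp [N₁, coords]
  · change (slAction k A Z).2.re = eval _ (N₂ * D₁) / _
    rw [re_snd_slAction, map_mul, e1, mul_comm _ (absSq _ _ Z.1), mul_div_mul_left _ _ h1]
    simp [N₂, coords]
  · change (slAction k A Z).1.im = eval _ (X 2 * D₂) / _
    rw [im_fst_slAction, map_mul, e2, mul_div_mul_right _ _ h2]
    simp [coords]
  · change (slAction k A Z).2.im = eval _ (X 3 * D₁) / _
    rw [im_snd_slAction, map_mul, e1, mul_comm _ (absSq _ _ Z.1), mul_div_mul_left _ _ h1]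
    simp [coords]

/-- A translate of a set of dimension at most two is avoided by a generic line of given direction:
the shifts of the lines that meet it lie in the zero set of a nonzero polynomial. -/
theorem exists_polynomial_line_avoids {k : ℕ} (A : SL(2, R k)) {T : Set (ℍ × ℍ)}
    (hT : semialgebraicDim (coords '' T) < 3) {P Q : Fin 4 → ℝ} (hPQ : P 0 ≠ Q 0) :
    ∃ G : MvPolynomial (Fin 3) ℝ, G ≠ 0 ∧ ∀ Z ∈ T, ∀ w t,
      coords (slAction k A Z) = linePt P Q w t → eval w G = 0 := by
  obtain ⟨D, N, hDN⟩ := exists_coords_slAction_eq_div A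
  have hPQ' : Q 0 - P 0 ≠ 0 := sub_ne_zero.2 hPQ.symm
  -- the shift of the line through a point is an affine function of its coordinates
  let slope : Fin 3 → ℝ := fun i => (Q i.succ - P i.succ) / (Q 0 - P 0)
  obtain ⟨G, hG, hG'⟩ := exists_eval_div_eq_zero_of_semialgebraicDim_lt (m := 3) hT D
    (by rintro _ ⟨Z, -, rfl⟩; exact (hDN Z).1)
    fun i => N i.succ - C (slope i) * N 0 + C (slope i * P 0 - P i.succ) * D
  refine ⟨G, hG, fun Z hZ w t h => ?_⟩
  rw [← hG' _ ⟨Z, hZ, rfl⟩]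
  congr 2
  ext i
  have hD := (hDN Z).1
  have h0 := (hDN Z).2 0
  have hi := (hDN Z).2 i.succ
  rw [h] at h0 hi
  simp only [linePt, Fin.cons_zero, Fin.cons_succ, add_zero] at h0 hi
  rw [map_add, map_sub, map_mul, map_mul, eval_C, eval_C, add_div, sub_div, mul_div_assoc, ← hi,
    ← h0, mul_div_assoc, div_self hD]
  simp only [slope]
  field_simp
  ring

/-! ### Generation by pairing transformations -/

theorem closure_isPairing_eq_top {k : ℕ} (hk : Squarefree k) (hk1 : 1 < k) :
    Subgroup.closure {γ : Γ k | IsPairing k γ} = ⊤ := by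
  set H : Subgroup SL(2, R k) := (Subgroup.closure {γ : Γ k | IsPairing k γ}).comap
    (QuotientGroup.mk' _) with hH
  rw [Subgroup.eq_top_iff']
  intro γ₁
  obtain ⟨B₁, rfl⟩ := QuotientGroup.mk_surjective γ₁
  by_contra hB₁
  replace hB₁ : B₁ ∉ H := hB₁
  -- a point `Q` that `B₁` moves into the interior of `𝓕`, and an interior point `P` of `𝓕`
  obtain ⟨Q', hQ', -⟩ := exists_mem_openF hk hk1 (x := 0) (by norm_num)
  obtain ⟨Q, rfl⟩ := (slAction k B₁).surjective Q'
  obtain ⟨P, hP, hPQ⟩ : ∃ P ∈ openF k, P.1.re ≠ Q.1.re := by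
    by_cases h : Q.1.re = 0
    · obtain ⟨P, hP, hx⟩ := exists_mem_openF hk hk1 (x := 1 / 4) (by norm_num [abs_of_pos])
      exact ⟨P, hP, by rw [hx, h]; norm_num⟩
    · obtain ⟨P, hP, hx⟩ := exists_mem_openF hk hk1 (x := 0) (by norm_num)
      exact ⟨P, hP, by rw [hx]; exact Ne.symm h⟩
  -- a generic small shift `w` of the segment from `P` to `Q`
  have hcount : Countable (R k) := (QuadraticAlgebra.equivProd (p k) (q k)).countable_iff.2
    inferInstance
  have hcountM : Countable (Matrix (Fin 2) (Fin 2) (R k)) :=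
    inferInstanceAs (Countable (Fin 2 → Fin 2 → R k))
  have hcountSL : Countable SL(2, R k) := Subtype.countable
  choose G hG0 hG using fun x : {x : SL(2, R k) × SL(2, R k) //
      semialgebraicDim (coords '' S k (QuotientGroup.mk x.2)) < 3} =>
    exists_polynomial_line_avoids x.1.1 x.2 (P := coords P) (Q := coords Q) hPQ
  have hw0 : linePt (coords P) (coords Q) 0 0 = coords P := by
    ext i
    refine Fin.cases ?_ (fun j => ?_) i <;> simp [linePt]
  have hw1 : linePt (coords P) (coords Q) 0 1 = coords Q := by
    ext i
    refine Fin.cases ?_ (fun j => ?_) i <;> simp [linePt]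
  have hev0 := (continuous_linePt_left (coords P) (coords Q) 0).continuousAt.eventually
    (hw0 ▸ eventually_ofCoords_mem (isOpen_openF k) hP)
  have hev1 := (continuous_linePt_left (coords P) (coords Q) 1).continuousAt.eventually
    (hw1 ▸ eventually_ofCoords_mem ((isOpen_openF k).preimage (continuous_slAction B₁)) hQ')
  obtain ⟨w, ⟨⟨hwP, h02, h03⟩, hwQ, h12, h13⟩, hwG⟩ :=
    ((mem_closure_iff_frequently.1 (MvPolynomial.dense_setOf_forall_eval_ne_zero hG0 0)).and_eventually
      (hev0.and hev1)).exists.imp fun _ h => And.symm h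
  obtain ⟨hconn, m, M, hm, hbox⟩ := isPreconnected_segment h02 h03 h12 h13
  -- the translates of `𝓕` meeting the segment form two finite families, hence two closed sets
  have hfin := finite_setOf_slAction_mem_F (M := M) hk hk1 hm
  set 𝓑 := {B : SL(2, R k) | ∃ Z ∈ box m M, slAction k B Z ∈ F k}
  have hclosed : ∀ B : SL(2, R k), IsClosed (slAction k B ⁻¹' F k) := fun B =>
    (isClosed_F k).preimage (continuous_slAction B)
  obtain ⟨Z, ⟨t, ht, rfl⟩, hU, hV⟩ := isPreconnected_closed_iff.1 hconn
    (⋃ B ∈ 𝓑 ∩ {B | B ∈ H}, slAction k B ⁻¹' F k) (⋃ B ∈ 𝓑 ∩ {B | B ∉ H}, slAction k B ⁻¹' F k)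
    ((hfin.subset Set.inter_subset_left).isClosed_biUnion fun B _ => hclosed B)
    ((hfin.subset Set.inter_subset_left).isClosed_biUnion fun B _ => hclosed B)
    (by
      rintro _ ⟨t, ht, rfl⟩
      obtain ⟨B, hB⟩ := exists_slAction_mem_F hk hk1 (ofCoords (linePt (coords P) (coords Q) w t))
      have hB' : B ∈ 𝓑 := ⟨_, (hbox t ht).1, hB⟩
      by_cases hBH : B ∈ H
      · exact Or.inl (Set.mem_biUnion ⟨hB', hBH⟩ hB)
      · exact Or.inr (Set.mem_biUnion ⟨hB', hBH⟩ hB))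
    (by
      have h : slAction k 1 (ofCoords (linePt (coords P) (coords Q) w 0)) ∈ F k := by
        rw [map_one]
        exact openF_subset_F hk hk1 hwP
      exact ⟨_, ⟨0, by simp, rfl⟩,
        Set.mem_biUnion ⟨⟨_, (hbox 0 (by simp)).1, h⟩, H.one_mem⟩ h⟩)
    (by
      have h : slAction k B₁ (ofCoords (linePt (coords P) (coords Q) w 1)) ∈ F k :=
        openF_subset_F hk hk1 hwQ
      exact ⟨_, ⟨1, by simp, rfl⟩,
        Set.mem_biUnion ⟨⟨_, (hbox 1 (by simp)).1, h⟩, hB₁⟩ h⟩)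
  obtain ⟨B, ⟨-, hBH⟩, hB⟩ := Set.mem_iUnion₂.1 hU
  obtain ⟨B', ⟨-, hBH'⟩, hB'⟩ := Set.mem_iUnion₂.1 hV
  have hcoords := (hbox t ht).2
  set Z := ofCoords (linePt (coords P) (coords Q) w t)
  -- `B' B⁻¹` is not a pairing transformation, so the segment was chosen to avoid `B⁻¹ S`
  have hC : B' * B⁻¹ ∉ H := fun h => hBH' (by simpa using H.mul_mem h hBH)
  have hC1 : (QuotientGroup.mk (B' * B⁻¹) : Γ k) ≠ 1 := fun h => hC (by
    change (QuotientGroup.mk (B' * B⁻¹) : Γ k) ∈ Subgroup.closure _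
    rw [h]
    exact Subgroup.one_mem _)
  have hdim : semialgebraicDim (coords '' S k (QuotientGroup.mk (B' * B⁻¹))) < 3 := by
    obtain ⟨p, hp, hp'⟩ := exists_polynomial_vanishing_on_S hk hk1 hC1
    exact lt_of_le_of_ne (semialgebraicDim_le_of_eval_eq_zero hp hp')
      fun h3 => hC (Subgroup.subset_closure ⟨hC1, h3⟩)
  refine hwG ⟨(B⁻¹, B' * B⁻¹), hdim⟩ (hG _ (slAction k B Z) ?_ w t ?_)
  · rw [mem_S_mk]
    refine ⟨hB, ?_⟩
    rw [← Equiv.Perm.mul_apply, ← map_mul, inv_mul_cancel_right]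
    exact hB'
  · rw [← Equiv.Perm.mul_apply, ← map_mul, inv_mul_cancel, map_one, Equiv.Perm.one_apply]
    exact hcoords

end HilbertModular

/-- For every square-free integer `k > 1`, the group `Γ = PSL₂(R)` is generated by the pairing
transformations of its fundamental domain `𝓕`. -/
theorem mainTheorem2 (k : ℕ) (hk : Squarefree k) (hk1 : 1 < k) :
    Subgroup.closure {γ : HilbertModular.Γ k | HilbertModular.IsPairing k γ} = ⊤ :=
  HilbertModular.closure_isPairing_eq_top hk hk1
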